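/- Let $K$ be a field, $n\ge 4$ and $0\le t\le n-4$ integers, and let $S=K[x_1,\dots,x_n]$ with the standard grading $\deg x_i=1$ and $\mathfrak m=(x_1,\dots,x_n)$. For $i\ge 1$ let $E_i=\Omega_i(K)$ be the $i$-th syzygy module of $K=S/\mathfrak m$, that is, the image of the differential $K_i\to K_{i-1}$ of the graded Koszul complex $K_\bullet$ of $x_1,\dots,x_n$, where $K_i\cong S(-i)^{\binom ni}$. Here $N(d)$ denotes the graded module with $N(d)_m=N_{m+d}$. Let $I\subset S$ be a graded ideal with $I\ne\mathfrak m$, let $c,d\in\mathbb Z$, let $a_1,\dots,a_p,b_1,\dots,b_q\in\mathbb Z$, and assume that there is an exact sequence of graded $S$-modules with homogeneous maps of degree $0$ (a long Bourbaki sequence) $$0\to\bigoplus_{i=1}^pS(-a_i)\to\bigoplus_{i=1}^qS(-b_i)\to E_{t+1}\oplus E_{n-1}(d)\to I(c)\to 0 .$$ Then $\operatorname{codim} I\le 3$, where $\operatorname{codim} I$ is the height of $I$. Moreover $\operatorname{codim} I=3$ if and only if the following three conditions all hold (with $\binom mk=0$ for $k<0$): 1. $q=p+\binom{n-1}{t}+n-2$;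 2. $\displaystyle\sum_{i=1}^qb_i-\sum_{i=1}^pa_i=n^2-(2+d)n+c+d+\binom{n-2}{t-1}+\binom{n-1}{t}\,t$; 3. $\displaystyle\sum_{i=1}^qb_i^2-\sum_{i=1}^pa_i^2=n^3-(3+2d)n^2+(d^2+4d+1)n-c^2-d^2+\binom{n-1}{t}(t+1)^2-\binom{n-2}{t}(2t+1)-2\binom{n-3}{t-1}$. -/

import Mathlib

noncomputable section

namespace LongBourbaki

/-- The polynomial ring `S = K[x₁, …, xₙ]`. -/
abbrev PolyRing (K : Type*) [Field K] (n : ℕ) : Type _ := MvPolynomial (Fin n) K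

section Graded

variable (K : Type*) [Field K] (n : ℕ)

/-- The homogeneous polynomials of degree `m`, for an integer `m` (only `0` if `m < 0`). -/
def homogPart (m : ℤ) : Submodule K (PolyRing K n) where
  carrier := {f | ∀ s ∈ f.support, ((Finsupp.degree s : ℕ) : ℤ) = m}
  zero_mem' := by simp
  add_mem' := by
    classical
    intro f g hf hg s hs
    rcases Finset.mem_union.mp (MvPolynomial.support_add hs) with h | h
    · exact hf s h
    · exact hg s h
  smul_mem' := by
    intro r f hf s hs
    exact hf s (MvPolynomial.support_smul hs)

/-- The ideal `I ⊂ S` is graded, for the standard grading with `deg xᵢ = 1`. -/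
def IsGradedIdeal {K : Type*} [Field K] {n : ℕ} (I : Ideal (PolyRing K n)) : Prop :=
  letI : GradedAlgebra (MvPolynomial.homogeneousSubmodule (Fin n) K) :=
    MvPolynomial.gradedAlgebra
  I.IsHomogeneous (MvPolynomial.homogeneousSubmodule (Fin n) K)

/-- The degree `m` part of the graded free module `⨁ᵢ S(-aᵢ)`: the `i`-th basis vector has
degree `aᵢ`, so the `i`-th coefficient of an element of degree `m` has degree `m - aᵢ`. -/
def freePart {ι : Type*} (a : ι → ℤ) (m : ℤ) : Submodule K (ι → PolyRing K n) :=
  Submodule.pi Set.univ fun i => homogPart K n (m - a i)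

/-- The degree `m` part of the twisted ideal `I(c)`, that is, the part of `I` of degree
`m + c`. -/
def idealPart (I : Ideal (PolyRing K n)) (c m : ℤ) : Submodule K I :=
  (homogPart K n (m + c)).comap (I.subtype.restrictScalars K)

/-- The total module `⨁ᵢ Kᵢ` of the Koszul complex of `x₁, …, xₙ`, in its standard basis:
`v` stands for `∑_L v(L) e_L`, where `L` runs through the subsets of `{1, …, n}`. -/
abbrev Koszul : Type _ := Finset (Fin n) → PolyRing K n

/-- The Koszul differential `∂ e_L = ∑_{j ∈ L} (-1)^{#{k ∈ L | k < j}} x_j e_{L ∖ {j}}`,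
written out in coefficients: the coefficient of `∂ v` at `e_J` collects the contributions of
`L = J ∪ {j}` with `j ∉ J`. -/
def koszulD : Koszul K n →ₗ[PolyRing K n] Koszul K n :=
  LinearMap.pi fun J =>
    ∑ j ∈ Jᶜ, ((-1 : PolyRing K n) ^ (J.filter (· < j)).card * MvPolynomial.X j) •
      LinearMap.proj (insert j J)

/-- The summand `Kᵢ` of the Koszul complex, spanned by the `e_L` with `#L = i`. -/
def koszulPart (i : ℕ) : Submodule (PolyRing K n) (Koszul K n) where
  carrier := {v | ∀ L, L.card ≠ i → v L = 0}
  zero_mem' := by intro L _; rfl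
  add_mem' := by
    intro v w hv hw L hL
    simp [hv L hL, hw L hL]
  smul_mem' := by
    intro r v hv L hL
    simp [hv L hL]

/-- For `i ≥ 1`, the `i`-th syzygy module `Eᵢ = Ωᵢ(K)` of the residue field
`K = S/(x₁, …, xₙ)`: the image of `∂ : Kᵢ → Kᵢ₋₁` in its minimal free resolution, the Koszul
complex. -/
def syzygy (i : ℕ) : Submodule (PolyRing K n) (Koszul K n) :=
  (koszulPart K n i).map (koszulD K n)

/-- The degree `m` part of `Eᵢ`, where the basis element `e_L` has degree `#L`. -/
def syzygyPart (i : ℕ) (m : ℤ) : Submodule K (syzygy K n i) :=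
  (freePart K n (fun L : Finset (Fin n) => (L.card : ℤ)) m).comap
    ((syzygy K n i).subtype.restrictScalars K)

/-- The degree `m` part of `Eᵢ ⊕ Eⱼ(d)`, where `Eⱼ(d)` has degree `m` part `(Eⱼ)_{m + d}`. -/
def sumPart (i j : ℕ) (d m : ℤ) : Submodule K (syzygy K n i × syzygy K n j) :=
  (syzygyPart K n i m).prod (syzygyPart K n j (m + d))

end Graded

/-- An `S`-linear map is homogeneous of degree `0` for the given graded pieces. -/
def IsGradedHom {K : Type*} [Field K] {n : ℕ} {M N : Type*} [AddCommGroup M] [AddCommGroup N]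
    [Module (PolyRing K n) M] [Module (PolyRing K n) N] [Module K M] [Module K N]
    (𝒜 : ℤ → Submodule K M) (ℬ : ℤ → Submodule K N) (f : M →ₗ[PolyRing K n] N) : Prop :=
  ∀ m : ℤ, ∀ x ∈ 𝒜 m, f x ∈ ℬ m

/-- The sequence of graded `S`-modules and homogeneous maps of degree `0`
`0 → ⨁ᵢ S(-aᵢ) → ⨁ᵢ S(-bᵢ) → E_{t+1} ⊕ E_{n-1}(d) → I(c) → 0`,
with maps `f`, `g`, `φ`, is exact. -/
structure IsLongBourbakiSequence {K : Type*} [Field K] {n t p q : ℕ} (d c : ℤ)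
    (a : Fin p → ℤ) (b : Fin q → ℤ) (I : Ideal (PolyRing K n))
    (f : (Fin p → PolyRing K n) →ₗ[PolyRing K n] (Fin q → PolyRing K n))
    (g : (Fin q → PolyRing K n) →ₗ[PolyRing K n] syzygy K n (t + 1) × syzygy K n (n - 1))
    (φ : (syzygy K n (t + 1) × syzygy K n (n - 1)) →ₗ[PolyRing K n] I) : Prop where
  graded_f : IsGradedHom (freePart K n a) (freePart K n b) f
  graded_g : IsGradedHom (freePart K n b) (sumPart K n (t + 1) (n - 1) d) g
  graded_φ : IsGradedHom (sumPart K n (t + 1) (n - 1) d) (idealPart K n I c) φ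
  injective_f : Function.Injective f
  exact_f_g : Function.Exact f g
  exact_g_φ : Function.Exact g φ
  surjective_φ : Function.Surjective φ

/-- The binomial coefficient with integer lower entry: it is `0` if the lower entry is
negative. -/
def binom (m : ℕ) (k : ℤ) : ℤ := if 0 ≤ k then (m.choose k.toNat : ℤ) else 0

end LongBourbaki

end

/-!
Write `S = K[x₁, …, xₙ]`, `𝔪 = (x₁, …, xₙ)`, `X = S/I` and `M = E_{t+1} ⊕ E_{n-1}(d)`.

**The bound `codim I ≤ 3`.** Suppose `height I ≥ 4`. The grade of an ideal of `S` is at least its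
height (`extKilledBy_one_of_lt_height`), so `Extⁱ(X, S) = 0` for `i ≤ 3`. The image `N` of `g` has
projective dimension at most one, so `Ext²(X, N) = 0`, and there are maps
`Hom(X, X) ↪ Ext¹(X, I) ↞ Ext¹(X, M) ↞ Ext¹(X, E_{t+1})`, the last one because `E_{n-1}` has
projective dimension one. By the exactness of the Koszul complex (`mem_syzygy_succ_iff`)
`Ext¹(X, E_{t+1}) = Hom(X, K_t / E_{t+1})`, where `K_t / E_{t+1}` is torsion free for `t ≥ 1` and is
`S/𝔪` for `t = 0`; in both cases `𝔪` kills it. Hence `𝔪` kills `Hom(X, X)`, that is `𝔪 ⊆ I`, and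
as `I ≠ 𝔪` only `I = S` is left. In that case `Ext^{t+1}(S/𝔪, -)` vanishes on `N` and on `I`, so on
`E_{t+1}`, whereas `Ext^{t+1}(S/𝔪, E_{t+1}) ≠ 0`. No Ext groups are computed: the argument only
traces which elements of `S` act as zero on them, through the predicate `ExtKilledBy`.

**The numerical criterion.** Taking dimensions in each degree of the exact sequence and of the
Koszul complex writes the Hilbert function of `S/I` (shifted by `c`) as a combination
`∑ wᵢ D(m + rᵢ)` of translates of the Hilbert function `D` of `S`, which agrees with a polynomial of
degree `n - 1`. By comparing coefficients such a combination has degree less than `n - 3` if and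
only if its moments `∑ wᵢ rᵢ^k` vanish for `k = 0, 1, 2` (`degree_sum_taylor_lt_iff`), and these
three equations are the conditions of the theorem once the alternating binomial sums coming from the
Koszul complex are evaluated (`altBinomSum_one`, `altBinomSum_id`, `altBinomSum_sq`).

It remains to see that `height I ≥ 3` if and only if the Hilbert polynomial of `S/I` has degree less
than `n - 3` (`le_height_iff_degree_lt`). The link is algebraic independence of sets of variables
modulo `I`: if `height I ≥ h`, any `n - h + 1` variables are dependent modulo `I`, and the leading
monomials of the relations leave only `O(m ^ (n - h - 1))` standard monomials of degree `m`; if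
`height I < h`, some `n - h + 1` variables are independent modulo `I`, and their monomials give a
lower bound of order `m ^ (n - h)`.
-/

noncomputable section

namespace LongBourbaki

open CategoryTheory CategoryTheory.Abelian
open scoped Pointwise

universe u

section ExtVanishing

/-! ### Elements acting as zero on Ext groups -/

variable {R : Type u} [CommRing R]

/-- Multiplication by `r` is zero on `Extⁱ(X, Y)`. With `r = 1` this says `Extⁱ(X, Y) = 0`. -/
def ExtKilledBy (r : R) (X Y : Type u) [AddCommGroup X] [Module R X] [AddCommGroup Y] [Module R Y]
    (i : ℕ) : Prop :=
  ∀ e : Ext (ModuleCat.of R X) (ModuleCat.of R Y) i, r • e = 0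

variable {X A B C : Type u} [AddCommGroup X] [Module R X] [AddCommGroup A] [Module R A]
  [AddCommGroup B] [Module R B] [AddCommGroup C] [Module R C]

lemma ExtKilledBy.eq_zero {i : ℕ} (h : ExtKilledBy (1 : R) X A i)
    (e : Ext (ModuleCat.of R X) (ModuleCat.of R A) i) : e = 0 := by
  rw [← one_smul R e, h e]

lemma ExtKilledBy.of_one {i : ℕ} (h : ExtKilledBy (1 : R) X A i) (r : R) :
    ExtKilledBy r X A i := fun e => by rw [h.eq_zero e, smul_zero]

lemma extKilledBy_of_smul_eq_zero {r : R} (hr : ∀ x : X, r • x = 0) (i : ℕ) :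
    ExtKilledBy r X A i := by
  intro e
  have h0 : r • 𝟙 (ModuleCat.of R X) = 0 := by
    ext x
    exact hr x
  have : r • e = (Ext.mk₀ (r • 𝟙 (ModuleCat.of R X))).comp e (zero_add i) := by
    simp [Ext.mk₀_smul]
  rw [this, h0, Ext.mk₀_zero, Ext.zero_comp]

lemma extKilledBy_zero_iff {r : R} :
    ExtKilledBy r X A 0 ↔ ∀ f : X →ₗ[R] A, r • f = 0 := by
  constructor
  · intro h f
    have h1 := h (Ext.mk₀ (ModuleCat.ofHom f))
    rw [← Ext.mk₀_smul] at h1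
    have h2 : r • ModuleCat.ofHom f = 0 := by
      rw [← Ext.mk₀_zero] at h1
      exact Ext.addEquiv₀.symm.injective h1
    have := congrArg ModuleCat.Hom.hom h2
    simpa using this
  · intro h e
    obtain ⟨f, rfl⟩ := Ext.addEquiv₀.symm.surjective e
    have : r • f = 0 := by
      ext x
      exact DFunLike.congr_fun (h f.hom) x
    change r • Ext.mk₀ f = 0
    rw [← Ext.mk₀_smul, this, Ext.mk₀_zero]

/-- If the identity of `Y` is a finite sum of maps factoring through `A`, vanishing of
`Extⁱ(X, A)` carries over to `Y`. -/
lemma ExtKilledBy.of_sum_comp_eq_id {ι : Type*} (s : Finset ι) {r : R} {i : ℕ}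
    (h : ExtKilledBy r X A i) (f : ι → B →ₗ[R] A) (g : ι → A →ₗ[R] B)
    (hfg : ∀ x, ∑ j ∈ s, g j (f j x) = x) : ExtKilledBy r X B i := by
  intro e
  have h1 : 𝟙 (ModuleCat.of R B) = ∑ j ∈ s, ModuleCat.ofHom (f j) ≫ ModuleCat.ofHom (g j) := by
    ext x
    simp [ModuleCat.hom_sum, hfg]
  have h2 : e = ∑ j ∈ s, (e.comp (Ext.mk₀ (ModuleCat.ofHom (f j))) (add_zero i)).comp
      (Ext.mk₀ (ModuleCat.ofHom (g j))) (add_zero i) := by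
    conv_lhs => rw [← Ext.comp_mk₀_id e, h1]
    have : Ext.mk₀ (∑ j ∈ s, ModuleCat.ofHom (f j) ≫ ModuleCat.ofHom (g j)) =
        ∑ j ∈ s, Ext.mk₀ (ModuleCat.ofHom (f j) ≫ ModuleCat.ofHom (g j)) :=
      map_sum Ext.addEquiv₀.symm _ _
    rw [this]
    refine (map_sum (AddMonoidHom.mk' (fun b : Ext (ModuleCat.of R B) (ModuleCat.of R B) 0 =>
      e.comp b (add_zero i)) (fun a b => Ext.comp_add _ _ _ _)) _ s).trans
      (Finset.sum_congr rfl fun j _ => ?_)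
    simp only [AddMonoidHom.mk'_apply]
    rw [← Ext.mk₀_comp_mk₀, Ext.comp_assoc_of_third_deg_zero]
  rw [h2, Finset.smul_sum]
  refine Finset.sum_eq_zero fun j _ => ?_
  rw [← Ext.smul_comp, h, Ext.zero_comp]

lemma ExtKilledBy.of_retract {r : R} {i : ℕ} (h : ExtKilledBy r X A i) (f : B →ₗ[R] A)
    (g : A →ₗ[R] B) (hfg : ∀ x, g (f x) = x) : ExtKilledBy r X B i :=
  h.of_sum_comp_eq_id (ι := Unit) {()} (fun _ => f) (fun _ => g) (by simpa using hfg)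

lemma ExtKilledBy.congr_left {r : R} {i : ℕ} {X' : Type u} [AddCommGroup X'] [Module R X']
    (h : ExtKilledBy r X A i) (φ : X' ≃ₗ[R] X) : ExtKilledBy r X' A i := by
  intro e
  have h1 : e = (Ext.mk₀ (ModuleCat.ofHom φ.toLinearMap)).comp
      ((Ext.mk₀ (ModuleCat.ofHom φ.symm.toLinearMap)).comp e (zero_add i)) (zero_add i) := by
    rw [Ext.mk₀_comp_mk₀_assoc, ← ModuleCat.ofHom_comp]
    have : φ.symm.toLinearMap ∘ₗ φ.toLinearMap = LinearMap.id := by ext x; simp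
    rw [this]
    exact (Ext.mk₀_id_comp e).symm
  rw [h1, ← Ext.comp_smul, h, Ext.comp_zero]

variable {f : A →ₗ[R] B} {g : B →ₗ[R] C}

lemma shortExact_of_exact (hf : Function.Injective f) (hfg : Function.Exact f g)
    (hg : Function.Surjective g) :
    (ShortComplex.mk (ModuleCat.ofHom f) (ModuleCat.ofHom g) (by
      ext x; exact hfg.apply_apply_eq_zero x)).ShortExact :=
  { exact := (ShortComplex.ShortExact.moduleCat_exact_iff_function_exact _).mpr hfg
    mono_f := (ModuleCat.mono_iff_injective _).mpr hf
    epi_g := (ModuleCat.epi_iff_surjective _).mpr hg }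

section

variable (hf : Function.Injective f) (hfg : Function.Exact f g) (hg : Function.Surjective g)
include hf hfg hg

/-- `Extⁱ(X, C) → Extⁱ⁺¹(X, A)` is injective if `Extⁱ(X, B) = 0`. -/
lemma ExtKilledBy.right_of_left {r : R} {i : ℕ} (hB : ExtKilledBy (1 : R) X B i)
    (hA : ExtKilledBy r X A (i + 1)) : ExtKilledBy r X C i := by
  intro e
  have h1 : (r • e).comp (shortExact_of_exact hf hfg hg).extClass rfl = 0 := by
    rw [Ext.smul_comp]; exact hA _
  obtain ⟨b, hb⟩ := Ext.covariant_sequence_exact₃ _ _ _ rfl h1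
  rw [← hb, hB.eq_zero b, Ext.zero_comp]

/-- `Extⁱ(X, C) → Extⁱ⁺¹(X, A)` is surjective if `Extⁱ⁺¹(X, B) = 0`. -/
lemma ExtKilledBy.left_of_right {r : R} {i : ℕ} (hB : ExtKilledBy (1 : R) X B (i + 1))
    (hC : ExtKilledBy r X C i) : ExtKilledBy r X A (i + 1) := by
  intro e
  obtain ⟨c, rfl⟩ := Ext.covariant_sequence_exact₁ _ (shortExact_of_exact hf hfg hg) e
    (hB.eq_zero _) rfl
  rw [← Ext.smul_comp, hC, Ext.zero_comp]

/-- `Extⁱ(X, B) → Extⁱ(X, C)` is surjective if `Extⁱ⁺¹(X, A) = 0`. -/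
lemma ExtKilledBy.right_of_middle {r : R} {i : ℕ} (hA : ExtKilledBy (1 : R) X A (i + 1))
    (hB : ExtKilledBy r X B i) : ExtKilledBy r X C i := by
  intro e
  obtain ⟨b, hb⟩ := Ext.covariant_sequence_exact₃ _ (shortExact_of_exact hf hfg hg) e rfl
    (hA.eq_zero _)
  rw [← hb, ← Ext.smul_comp, hB, Ext.zero_comp]

/-- `Extⁱ(X, A) → Extⁱ(X, B)` is surjective if `Extⁱ(X, C) = 0`. -/
lemma ExtKilledBy.middle_of_left {r : R} {i : ℕ} (hC : ExtKilledBy (1 : R) X C i)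
    (hA : ExtKilledBy r X A i) : ExtKilledBy r X B i := by
  intro e
  obtain ⟨b, hb⟩ := Ext.covariant_sequence_exact₂ _ (shortExact_of_exact hf hfg hg) e
    (hC.eq_zero _)
  rw [← hb, ← Ext.smul_comp, hA, Ext.zero_comp]

end

/-- A regular element acting on `A` and killing `X` shifts the vanishing of `Ext` by one. -/
lemma ExtKilledBy.succ_of_quotSMulTop {r : R} (hr : ∀ x : X, r • x = 0) (hreg : IsSMulRegular A r)
    {i : ℕ} (h : ExtKilledBy (1 : R) X (QuotSMulTop r A) i) : ExtKilledBy (1 : R) X A (i + 1) := by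
  intro e
  have hse := IsSMulRegular.smulShortComplex_shortExact (M := ModuleCat.of R A) hreg
  have h1 : e.comp (Ext.mk₀ ((ModuleCat.of R A).smulShortComplex r).f) (add_zero _) = 0 := by
    exact (congrArg (fun a => e.comp (Ext.mk₀ a) (add_zero _))
      (ModuleCat.smulShortComplex_f_eq_smul_id (ModuleCat.of R A) r)).trans
      ((Ext.smul_eq_comp_mk₀ e r).symm.trans (extKilledBy_of_smul_eq_zero hr (i + 1) e))
  obtain ⟨c, hc⟩ := Ext.covariant_sequence_exact₁ _ hse e h1 rfl
  have hc0 : c = 0 := h.eq_zero c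
  have he : e = 0 := by
    rw [← hc, hc0, Ext.zero_comp]
    rfl
  rw [he, smul_zero]

lemma extKilledBy_zero_of_isSMulRegular {r : R} (hr : ∀ x : X, r • x = 0)
    (hreg : IsSMulRegular A r) : ExtKilledBy (1 : R) X A 0 := by
  rw [extKilledBy_zero_iff]
  intro f
  ext x
  apply hreg
  simp [← map_smul, hr]

/-- The elementary half of Rees' theorem: a weakly `A`-regular sequence of length `k`
annihilating `X` forces `Extⁱ(X, A) = 0` for `i < k`. -/
lemma extKilledBy_of_isWeaklyRegular (rs : List R) :
    ∀ {A : Type u} [AddCommGroup A] [Module R A], RingTheory.Sequence.IsWeaklyRegular A rs →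
    (∀ r ∈ rs, ∀ x : X, r • x = 0) → ∀ i < rs.length, ExtKilledBy (1 : R) X A i := by
  induction rs with
  | nil => intro A _ _ _ _ i hi; simp at hi
  | cons r rs ih =>
    intro A _ _ hreg hX i hi
    rw [RingTheory.Sequence.isWeaklyRegular_cons_iff] at hreg
    have hr := hX r (by simp)
    cases i with
    | zero => exact extKilledBy_zero_of_isSMulRegular hr hreg.1
    | succ i =>
      refine ExtKilledBy.succ_of_quotSMulTop hr hreg.1 ?_
      exact ih hreg.2 (fun r' h => hX r' (by simp [h])) i (by simpa using hi)

end ExtVanishing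

section Grade

/-! ### Grade and height in a polynomial ring -/

open RingTheory.Sequence Polynomial in
lemma isWeaklyRegular_map_C_append_monic {R : Type*} [CommRing R] {rs : List R}
    (h : IsWeaklyRegular R rs) {f : R[X]} (hf : f.Monic) :
    IsWeaklyRegular R[X] (rs.map C ++ [f]) := by
  rw [isWeaklyRegular_append_iff]
  refine ⟨h.of_flat (S := R[X]), ?_⟩
  rw [isWeaklyRegular_singleton_iff, isSMulRegular_iff_right_eq_zero_of_smul]
  intro x
  obtain ⟨g, rfl⟩ := Submodule.Quotient.mk_surjective _ x
  have key : ∀ p : R[X], p ∈ (Ideal.ofList (rs.map C) • ⊤ : Submodule R[X] R[X]) ↔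
      p.map (Ideal.Quotient.mk (Ideal.ofList rs)) = 0 := by
    intro p
    rw [← Ideal.map_ofList, smul_eq_mul, Ideal.mul_top, Ideal.mem_map_C_iff, Polynomial.ext_iff]
    simp [Ideal.Quotient.eq_zero_iff_mem]
  rw [← Submodule.Quotient.mk_smul, Submodule.Quotient.mk_eq_zero, Submodule.Quotient.mk_eq_zero,
    key, key, smul_eq_mul, Polynomial.map_mul]
  intro h0
  by_contra hne
  exact hne ((hf.map _).mul_right_eq_zero_iff.mp h0)

/-- A maximal ideal of `K[x₁, …, xₙ]` contains a weakly regular sequence of length `n`. -/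
lemma exists_isWeaklyRegular_of_isMaximal (K : Type*) [Field K] (n : ℕ) :
    ∀ (P : Ideal (MvPolynomial (Fin n) K)) [P.IsMaximal], ∃ rs : List (MvPolynomial (Fin n) K),
      rs.length = n ∧ (∀ r ∈ rs, r ∈ P) ∧
      RingTheory.Sequence.IsWeaklyRegular (MvPolynomial (Fin n) K) rs := by
  induction n with
  | zero => exact fun P _ => ⟨[], rfl, by simp, by simp⟩
  | succ n ih =>
    intro P hP
    let e := (MvPolynomial.finSuccEquiv K n).toRingEquiv
    let Q : Ideal (Polynomial (MvPolynomial (Fin n) K)) := P.comap e.symm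
    have hQ : Q.IsMaximal := Ideal.comap_isMaximal_of_equiv e.symm
    -- by the Nullstellensatz `Q` contracts to a maximal ideal of `K[x₁, …, xₙ]`, over whose
    -- residue field the last variable is integral: this gives a monic polynomial in `Q`
    have := Polynomial.isMaximal_comap_C_of_isJacobsonRing Q
    obtain ⟨rs, hlen, hmem, hreg⟩ := ih (Q.comap Polynomial.C)
    obtain ⟨f, hf, hf0⟩ := Polynomial.quotient_mk_comp_C_isIntegral_of_isJacobsonRing Q
      (Ideal.Quotient.mk Q Polynomial.X)
    have hfQ : f ∈ Q := by
      rw [← Ideal.Quotient.eq_zero_iff_mem, ← hf0, ← Polynomial.hom_eval₂,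
        Polynomial.eval₂_C_X]
    refine ⟨(rs.map Polynomial.C ++ [f]).map e.symm, by simp [hlen], ?_, ?_⟩
    · intro r hr
      rw [List.mem_map] at hr
      obtain ⟨s, hs, rfl⟩ := hr
      suffices s ∈ Q from this
      rcases List.mem_append.mp hs with hs | hs
      · obtain ⟨s', hs', rfl⟩ := List.mem_map.mp hs
        exact hmem s' hs'
      · rw [List.mem_singleton.mp hs]
        exact hfQ
    · refine (AddEquiv.isWeaklyRegular_congr (e := e.symm.toAddEquiv) ?_).mp
        (isWeaklyRegular_map_C_append_monic hreg hf)
      rw [List.forall₂_map_right_iff]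
      exact List.forall₂_same.mpr fun r _ x => map_mul e.symm r x

variable {K : Type u} [Field K] {n : ℕ}

/-- `Ext` into a module over a Noetherian ring vanishes on every finite module killed by `I` once
it vanishes on `R/Q` for all primes `Q` containing `I`. -/
lemma extKilledBy_one_of_forall_prime {R : Type u} [CommRing R] [IsNoetherianRing R] (I : Ideal R)
    {A : Type u} [AddCommGroup A] [Module R A] (i : ℕ)
    (h : ∀ Q : Ideal R, Q.IsPrime → I ≤ Q → ExtKilledBy (1 : R) (R ⧸ Q) A i)
    (M : Type u) [AddCommGroup M] [Module R M] [Module.Finite R M]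
    (hM : ∀ r ∈ I, ∀ x : M, r • x = 0) : ExtKilledBy (1 : R) M A i := by
  revert hM
  induction ‹Module.Finite R M› using
    IsNoetherianRing.induction_on_isQuotientEquivQuotientPrime R with
  | subsingleton N => exact fun _ => extKilledBy_of_smul_eq_zero (fun x => Subsingleton.elim _ _) i
  | quotient N p e =>
    intro hM
    refine (h p.1 p.2 fun r hr => ?_).congr_left e
    have h1 := hM r hr (e.symm 1)
    rw [← map_smul, map_eq_zero_iff _ e.symm.injective] at h1
    rw [← Ideal.Quotient.eq_zero_iff_mem, ← h1, Algebra.smul_def, mul_one]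
    rfl
  | exact N₁ N₂ N₃ f g hf hg hfg h₁ h₃ =>
    intro hM x
    have hse := shortExact_of_exact hf hfg hg
    have h1 := h₁ fun r hr x => hf (by rw [map_smul, hM r hr, map_zero])
    have h3 := h₃ fun r hr x => by
      obtain ⟨y, rfl⟩ := hg x
      rw [← map_smul, hM r hr, map_zero]
    obtain ⟨y, hy⟩ := Ext.contravariant_sequence_exact₂ hse _ x (h1.eq_zero _)
    rw [← hy, h3.eq_zero y, Ext.comp_zero, smul_zero]

/-- `Extⁱ(S/P, S) = 0` for a prime `P` of `S = K[x₁, …, xₙ]` and `i < height P`. For maximal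
`P` there is an explicit regular sequence; otherwise every `y ∉ P` acts surjectively on
`Extⁱ(S/P, S)`, because `S/(P + y)` is supported in larger height, and Nakayama applies. -/
lemma extKilledBy_one_quotient_prime (P : Ideal (MvPolynomial (Fin n) K)) (hP : P.IsPrime)
    (i : ℕ) (hi : (i : ℕ∞) < P.height) :
    ExtKilledBy (1 : MvPolynomial (Fin n) K) (MvPolynomial (Fin n) K ⧸ P)
      (MvPolynomial (Fin n) K) i := by
  induction P using WellFoundedGT.induction generalizing i with
  | ind P ih =>
  by_cases hmax : P.IsMaximal
  · obtain ⟨rs, hlen, hmem, hreg⟩ := exists_isWeaklyRegular_of_isMaximal K n P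
    refine extKilledBy_of_isWeaklyRegular rs hreg (fun r hr x => ?_) i ?_
    · obtain ⟨x, rfl⟩ := Ideal.Quotient.mk_surjective x
      change Ideal.Quotient.mk P (r * x) = 0
      exact Ideal.Quotient.eq_zero_iff_mem.mpr (P.mul_mem_right _ (hmem r hr))
    · have h1 := Ideal.height_le_ringKrullDim_of_ne_top hP.ne_top
      rw [MvPolynomial.ringKrullDim_of_isNoetherianRing, ringKrullDim_eq_zero_of_field] at h1
      simp only [Nat.card_eq_fintype_card, Fintype.card_fin, zero_add] at h1
      have h2 : P.height ≤ (n : ℕ∞) := by exact_mod_cast h1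
      rw [hlen]
      exact_mod_cast hi.trans_le h2
  · let E := Ext (ModuleCat.of (MvPolynomial (Fin n) K) (MvPolynomial (Fin n) K ⧸ P))
      (ModuleCat.of (MvPolynomial (Fin n) K) (MvPolynomial (Fin n) K)) i
    -- multiplication by `y` is injective on `S/P`, and its cokernel lives over larger primes
    have hsurj : ∀ y ∉ P, ∀ e : E, ∃ e' : E, y • e' = e := by
      intro y hy e
      let f : (MvPolynomial (Fin n) K ⧸ P) →ₗ[MvPolynomial (Fin n) K]
        (MvPolynomial (Fin n) K ⧸ P) := LinearMap.lsmul _ _ y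
      have hf : Function.Injective f := by
        rw [injective_iff_map_eq_zero]
        intro x hx
        obtain ⟨x, rfl⟩ := Ideal.Quotient.mk_surjective x
        change Ideal.Quotient.mk P (y * x) = 0 at hx
        rw [Ideal.Quotient.eq_zero_iff_mem] at hx ⊢
        exact (hP.mem_or_mem hx).resolve_left hy
      have hse := shortExact_of_exact hf (f.exact_map_mkQ_range) (Submodule.mkQ_surjective _)
      have h3 : ExtKilledBy (1 : MvPolynomial (Fin n) K) ((MvPolynomial (Fin n) K ⧸ P) ⧸ f.range)
          (MvPolynomial (Fin n) K) (i + 1) := by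
        refine extKilledBy_one_of_forall_prime (P ⊔ Ideal.span {y}) _ (fun Q hQ hPQ => ?_) _ ?_
        · have hlt : P < Q := lt_of_le_of_ne (le_sup_left.trans hPQ) (by
            rintro rfl
            exact hy (hPQ (Ideal.mem_sup_right (Ideal.mem_span_singleton_self y))))
          refine ih Q hlt hQ (i + 1) ?_
          have h1 := Ideal.height_add_one_le_of_lt_of_isPrime hlt
          refine lt_of_lt_of_le ?_ h1
          push_cast
          exact (ENat.add_lt_add_iff_right (by simp)).mpr hi
        · intro r hr x
          obtain ⟨x, rfl⟩ := Submodule.mkQ_surjective _ x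
          obtain ⟨a, ha, b, hb, rfl⟩ := Submodule.mem_sup.mp hr
          obtain ⟨c, rfl⟩ := Ideal.mem_span_singleton'.mp hb
          rw [← map_smul]
          refine (Submodule.Quotient.mk_eq_zero _).mpr ⟨c • x, ?_⟩
          obtain ⟨x, rfl⟩ := Ideal.Quotient.mk_surjective x
          change Ideal.Quotient.mk P (y * (c * x)) = Ideal.Quotient.mk P ((a + c * y) * x)
          rw [Ideal.Quotient.eq]
          have : y * (c * x) - (a + c * y) * x = -x * a := by ring
          rw [this]
          exact P.mul_mem_left _ ha
      obtain ⟨e', he'⟩ := Ext.contravariant_sequence_exact₁ hse _ e (n₁ := i + 1) (add_comm 1 i)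
        (h3.eq_zero _)
      refine ⟨e', ?_⟩
      rw [← he']
      have : ModuleCat.ofHom f = y • 𝟙 (ModuleCat.of (MvPolynomial (Fin n) K)
          (MvPolynomial (Fin n) K ⧸ P))  := by ext; rfl
      change _ = (Ext.mk₀ (ModuleCat.ofHom f)).comp e' _
      rw [this, Ext.mk₀_smul, Ext.smul_comp, Ext.mk₀_id_comp]
    -- Nakayama for `y ∈ m \ P`: some `r ≡ 1 mod m` kills `E`, but `r ∉ P` acts surjectively
    obtain ⟨m, hm, hPm⟩ := P.exists_le_maximal hP.ne_top
    obtain ⟨y, hym, hyP⟩ := Set.exists_of_ssubset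
      (lt_of_le_of_ne hPm (fun h => hmax (SetLike.coe_injective h ▸ hm)))
    have hfin : Module.Finite (MvPolynomial (Fin n) K) E := by
      infer_instance
    obtain ⟨r, hr, hr0⟩ := Submodule.exists_sub_one_mem_and_smul_eq_zero_of_fg_of_le_smul m
      (⊤ : Submodule (MvPolynomial (Fin n) K) E) hfin.fg_top (by
        intro e _
        obtain ⟨e', rfl⟩ := hsurj y hyP e
        exact Submodule.smul_mem_smul hym trivial)
    have hrP : r ∉ P := fun h => hm.ne_top ((Ideal.eq_top_iff_one m).mpr (by
      simpa using m.sub_mem (hPm h) hr))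
    intro e
    obtain ⟨e', rfl⟩ := hsurj r hrP e
    rw [hr0 e' trivial, smul_zero]

/-- The grade of an ideal of `S = K[x₁, …, xₙ]` is at least its height. -/
lemma extKilledBy_one_of_lt_height (I : Ideal (MvPolynomial (Fin n) K)) (i : ℕ)
    (hi : (i : ℕ∞) < I.height) (M : Type u) [AddCommGroup M] [Module (MvPolynomial (Fin n) K) M]
    [Module.Finite (MvPolynomial (Fin n) K) M] (hM : ∀ r ∈ I, ∀ x : M, r • x = 0) :
    ExtKilledBy (1 : MvPolynomial (Fin n) K) M (MvPolynomial (Fin n) K) i :=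
  extKilledBy_one_of_forall_prime I i (fun Q hQ hIQ =>
    extKilledBy_one_quotient_prime Q hQ i (hi.trans_le (Ideal.height_mono hIQ))) M hM

end Grade

section KoszulComplex

/-! ### Exactness of the Koszul complex -/

variable {K : Type*} [Field K] {n : ℕ}

lemma koszulD_apply (v : Koszul K n) (J : Finset (Fin n)) :
    koszulD K n v J = ∑ j ∈ Jᶜ, ((-1 : PolyRing K n) ^ (J.filter (· < j)).card *
      MvPolynomial.X j) * v (insert j J) := by
  simp [koszulD, LinearMap.sum_apply]

lemma coeff_koszulD (v : Koszul K n) (J : Finset (Fin n)) (s : Fin n →₀ ℕ) :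
    (koszulD K n v J).coeff s = ∑ j ∈ Jᶜ, (-1 : K) ^ (J.filter (· < j)).card *
      if s j = 0 then 0 else (v (insert j J)).coeff (s - Finsupp.single j 1) := by
  rw [koszulD_apply, MvPolynomial.coeff_sum]
  refine Finset.sum_congr rfl fun j _ => ?_
  have : ((-1 : PolyRing K n) ^ (J.filter (· < j)).card) =
      MvPolynomial.C ((-1 : K) ^ (J.filter (· < j)).card) := by simp
  rw [this, mul_assoc, MvPolynomial.coeff_C_mul, MvPolynomial.coeff_X_mul']
  congr 1
  by_cases h : s j = 0 <;> simp [h]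

lemma koszulD_mem_koszulPart {v : Koszul K n} {i : ℕ} (hv : v ∈ koszulPart K n (i + 1)) :
    koszulD K n v ∈ koszulPart K n i := by
  intro J hJ
  rw [koszulD_apply]
  refine Finset.sum_eq_zero fun j hj => ?_
  rw [hv, mul_zero]
  rw [Finset.card_insert_of_notMem (by simpa using hj)]
  omega

lemma card_filter_insert_lt {J : Finset (Fin n)} {j k : Fin n} (hj : j ∉ J) :
    ((insert j J).filter (· < k)).card = (J.filter (· < k)).card + if j < k then 1 else 0 := by
  rw [Finset.filter_insert]
  split_ifs with h
  · rw [Finset.card_insert_of_notMem (by simp [hj])]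
  · rfl

lemma koszulD_koszulD (v : Koszul K n) : koszulD K n (koszulD K n v) = 0 := by
  ext1 J
  simp only [koszulD_apply, Finset.mul_sum, Pi.zero_apply]
  rw [Finset.sum_sigma']
  refine Finset.sum_involution (fun a _ => ⟨a.2, a.1⟩) ?_ ?_ ?_ ?_
  · rintro ⟨j, k⟩ hjk
    simp only [Finset.mem_sigma, Finset.mem_compl, Finset.mem_insert, not_or] at hjk
    obtain ⟨hj, hkj, hk⟩ := hjk
    simp only [card_filter_insert_lt hj, card_filter_insert_lt hk, Finset.insert_comm k j J]
    rcases lt_or_gt_of_ne hkj with h | h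
    · simp only [h, not_lt_of_gt h, if_true, if_false, pow_add, pow_zero, pow_one]
      ring
    · simp only [h, not_lt_of_gt h, if_true, if_false, pow_add, pow_zero, pow_one]
      ring
  · rintro ⟨j, k⟩ hjk _ h
    simp only [Finset.mem_sigma, Finset.mem_compl, Finset.mem_insert, not_or] at hjk
    exact hjk.2.1 (congrArg Sigma.fst h)
  · rintro ⟨j, k⟩ hjk
    simp only [Finset.mem_sigma, Finset.mem_compl, Finset.mem_insert, not_or] at hjk ⊢
    exact ⟨hjk.2.2, fun h => hjk.2.1 h.symm, hjk.1⟩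
  · rintro ⟨j, k⟩ hjk
    rfl

/-- A `K`-linear contraction of the Koszul complex, compatible with the `ℕⁿ`-grading in which
`x^s e_L` has degree `s + 1_L`: if `j` is the least index in the support of that degree, then
`x^s e_L ↦ x^(s - 1_j) e_{L ∪ j}` for `j ∉ L` and `x^s e_L ↦ 0` for `j ∈ L`. No sign occurs,
because `j` precedes all elements of `L`. The definition spells out the coefficient at `e_L`. -/
def koszulContraction (w : Koszul K n) : Koszul K n := fun L =>
  if hL : L.Nonempty then
    ∑ s ∈ (MvPolynomial.divMonomial (w (L.erase (L.min' hL)))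
        (Finsupp.single (L.min' hL) 1)).support.filter (fun s => ∀ k < L.min' hL, s k = 0),
      MvPolynomial.monomial s ((w (L.erase (L.min' hL))).coeff (Finsupp.single (L.min' hL) 1 + s))
  else 0

lemma coeff_koszulContraction (w : Koszul K n) {L : Finset (Fin n)} (hL : L.Nonempty)
    (s : Fin n →₀ ℕ) : (koszulContraction w L).coeff s =
      if ∀ k < L.min' hL, s k = 0 then
        (w (L.erase (L.min' hL))).coeff (Finsupp.single (L.min' hL) 1 + s) else 0 := by
  rw [koszulContraction, dif_pos hL, MvPolynomial.coeff_sum]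
  simp only [MvPolynomial.coeff_monomial, Finset.sum_ite_eq', Finset.mem_filter,
    MvPolynomial.mem_support_iff, MvPolynomial.coeff_divMonomial]
  by_cases h1 : ∀ k < L.min' hL, s k = 0
  · by_cases h2 : (w (L.erase (L.min' hL))).coeff (Finsupp.single (L.min' hL) 1 + s) = 0 <;>
      simp [h2]
  · rw [if_neg h1, if_neg (fun h => h1 (Finset.mem_filter.mp h).2)]

lemma coeff_koszulContraction_of_le (w : Koszul K n) {L : Finset (Fin n)} {i : Fin n}
    (hi : i ∈ L) (hmin : ∀ k ∈ L, i ≤ k) (s : Fin n →₀ ℕ) (hs : ∀ k < i, s k = 0) :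
    (koszulContraction w L).coeff s = (w (L.erase i)).coeff (Finsupp.single i 1 + s) := by
  have : L.min' ⟨i, hi⟩ = i := le_antisymm (Finset.min'_le _ _ hi) (Finset.le_min' _ _ _ hmin)
  rw [coeff_koszulContraction w ⟨i, hi⟩, this, if_pos hs]

lemma coeff_koszulContraction_of_lt (w : Koszul K n) {L : Finset (Fin n)} (hL : L.Nonempty)
    {i : Fin n} (hmin : ∀ k ∈ L, i < k) (s : Fin n →₀ ℕ) (hs : s i ≠ 0) :
    (koszulContraction w L).coeff s = 0 := by
  rw [coeff_koszulContraction w hL, if_neg]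
  exact fun h => hs (h i (hmin _ (Finset.min'_mem _ _)))

lemma koszulContraction_mem {w : Koszul K n} {i : ℕ} (hw : w ∈ koszulPart K n i) :
    koszulContraction w ∈ koszulPart K n (i + 1) := by
  intro L hLi
  ext s
  by_cases hL : L.Nonempty
  · rw [coeff_koszulContraction w hL, hw (L.erase (L.min' hL))]
    · simp
    · rw [Finset.card_erase_of_mem (Finset.min'_mem _ _)]
      have := hL.card_pos
      omega
  · simp [koszulContraction, hL]

lemma koszulD_koszulContraction_apply {w : Koszul K n} (hw : koszulD K n w = 0)
    {J : Finset (Fin n)} (hJ : J.Nonempty) : koszulD K n (koszulContraction w) J = w J := by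
  ext s
  rw [coeff_koszulD]
  -- `i` is the least index in the support of the multidegree of `x^s e_J`
  have hA : (s.support ∪ J).Nonempty := hJ.mono Finset.subset_union_right
  set i := (s.support ∪ J).min' hA with hi
  have hiJ : ∀ k ∈ J, i ≤ k := fun k hk => Finset.min'_le _ _ (Finset.mem_union_right _ hk)
  have his : ∀ k, s k ≠ 0 → i ≤ k := fun k hk =>
    Finset.min'_le _ _ (Finset.mem_union_left _ (by simpa using hk))
  have hs0 : ∀ k < i, s k = 0 := fun k hk => by
    by_contra h
    exact absurd (his k h) (not_le.mpr hk)
  have hmem : s i ≠ 0 ∨ i ∈ J := by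
    have := Finset.min'_mem _ hA
    rw [← hi, Finset.mem_union] at this
    simpa using this
  have hfil : J.filter (· < i) = ∅ :=
    Finset.filter_eq_empty_iff.mpr fun k hk => not_lt.mpr (hiJ k hk)
  by_cases h : i ∈ J
    -- the cycle condition at `e_{J ∖ i}` expresses the coefficient of `w` at `e_J`
  · have hz := congrArg (fun p => MvPolynomial.coeff (Finsupp.single i 1 + s) p)
      (congrFun hw (J.erase i))
    simp only [coeff_koszulD, Pi.zero_apply, MvPolynomial.coeff_zero] at hz
    have hc : (J.erase i)ᶜ = insert i Jᶜ := by
      ext k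
      simp only [Finset.mem_compl, Finset.mem_erase, Finset.mem_insert]
      tauto
    have hfil' : (J.erase i).filter (· < i) = ∅ := by
      rw [← Finset.subset_empty, ← hfil]
      exact Finset.filter_subset_filter _ (Finset.erase_subset _ _)
    rw [hc, Finset.sum_insert (by simpa using h), Finset.insert_erase h, hfil'] at hz
    simp only [Finset.card_empty, pow_zero, one_mul, Finsupp.add_apply, Finsupp.single_eq_same,
      Nat.add_eq_zero_iff, one_ne_zero, false_and, if_false, add_tsub_cancel_left] at hz
    rw [eq_comm, eq_neg_of_add_eq_zero_left hz, ← Finset.sum_neg_distrib]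
    refine Finset.sum_congr rfl fun j hj => ?_
    have hjJ : j ∉ J := by simpa using hj
    have hji : j ≠ i := by rintro rfl; exact hjJ h
    have hsj : (Finsupp.single i 1 : Fin n →₀ ℕ) j = 0 := by simp [hji.symm]
    simp only [hsj, true_and]
    split_ifs with h0
    · simp
    · have hij : i < j := lt_of_le_of_ne (his j h0) hji.symm
      rw [coeff_koszulContraction_of_le w (Finset.mem_insert_of_mem h)
        (fun k hk => (Finset.mem_insert.mp hk).elim (fun e => e ▸ hij.le) (hiJ k)) _
        (fun k hk => by simp [hs0 k hk])]
      have h1 : (J.filter (· < j)).card = ((J.erase i).filter (· < j)).card + 1 := by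
        conv_lhs => rw [← Finset.insert_erase h]
        rw [card_filter_insert_lt (Finset.notMem_erase _ _), if_pos hij]
      have h2 : insert j (J.erase i) = (insert j J).erase i := by
        rw [Finset.erase_insert_of_ne hji]
      have h3 : Finsupp.single i 1 + s - Finsupp.single j 1 =
          Finsupp.single i 1 + (s - Finsupp.single j 1) := by
        ext k
        simp only [Finsupp.coe_tsub, Finsupp.coe_add, Pi.sub_apply, Pi.add_apply]
        by_cases hk : k = j
        · subst hk
          simp [hji.symm]
        · simp [Ne.symm hk]
      rw [h1, h2, h3, pow_succ]
      ring
    -- only the summand at `e_{J ∪ i}` survives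
  · have hsi := hmem.resolve_right h
    rw [Finset.sum_eq_single_of_mem i (by simpa using h)]
    · rw [hfil, if_neg hsi, coeff_koszulContraction_of_le w (Finset.mem_insert_self _ _)
        (fun k hk => (Finset.mem_insert.mp hk).elim (fun e => e.ge) (hiJ k)) _
        (fun k hk => by simp [hs0 k hk]), Finset.erase_insert h]
      have : Finsupp.single i 1 + (s - Finsupp.single i 1) = s :=
        add_tsub_cancel_of_le (by simpa using Nat.one_le_iff_ne_zero.mpr hsi)
      rw [this]
      simp
    · intro j hj hji
      split_ifs with h0
      · simp
      · have hij : i < j := lt_of_le_of_ne (his j h0) hji.symm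
        rw [coeff_koszulContraction_of_lt w (Finset.insert_nonempty _ _) (i := i)
          (fun k hk => (Finset.mem_insert.mp hk).elim (fun e => e ▸ hij)
            (fun hk => lt_of_le_of_ne (hiJ k hk) (by rintro rfl; exact h hk))) _
            (by simpa [hji] using hsi), mul_zero]

/-- The Koszul complex of the variables is exact in positive degrees. -/
lemma mem_syzygy_succ_iff {w : Koszul K n} {i : ℕ} (hi : i ≠ 0) :
    w ∈ syzygy K n (i + 1) ↔ w ∈ koszulPart K n i ∧ koszulD K n w = 0 := by
  constructor
  · rintro ⟨v, hv, rfl⟩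
    exact ⟨koszulD_mem_koszulPart hv, koszulD_koszulD v⟩
  · rintro ⟨hw, hw0⟩
    refine ⟨koszulContraction w, koszulContraction_mem hw, ?_⟩
    ext1 J
    by_cases hJ : J.Nonempty
    · exact koszulD_koszulContraction_apply hw0 hJ
    · rw [Finset.not_nonempty_iff_eq_empty] at hJ
      subst hJ
      have h0 : (∅ : Finset (Fin n)).card ≠ i := by simpa using hi.symm
      rw [hw _ h0, koszulD_mem_koszulPart (koszulContraction_mem hw) _ h0]

lemma syzygy_succ_le_koszulPart (i : ℕ) : syzygy K n (i + 1) ≤ koszulPart K n i := by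
  rintro _ ⟨v, hv, rfl⟩
  exact koszulD_mem_koszulPart hv

/-- The first syzygy module is the maximal ideal `(x₁, …, xₙ)`, sitting in `K₀ = S e_∅`. -/
lemma mem_syzygy_one_iff {w : Koszul K n} : w ∈ syzygy K n 1 ↔ w ∈ koszulPart K n 0 ∧
    w ∅ ∈ Ideal.span (Set.range (MvPolynomial.X : Fin n → MvPolynomial (Fin n) K)) := by
  constructor
  · rintro ⟨v, hv, rfl⟩
    refine ⟨koszulD_mem_koszulPart hv, ?_⟩
    rw [koszulD_apply]
    refine Ideal.sum_mem _ fun j _ => Ideal.mul_mem_right _ _ (Ideal.mul_mem_left _ _ ?_)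
    exact Ideal.subset_span ⟨j, rfl⟩
  · rintro ⟨hw, hw0⟩
    obtain ⟨c, hc⟩ := (Submodule.mem_span_range_iff_exists_fun _).mp hw0
    refine ⟨fun L => ∑ j, if L = {j} then c j else 0, fun L hL => ?_, ?_⟩
    · refine Finset.sum_eq_zero fun j _ => if_neg ?_
      rintro rfl
      exact hL (by simp)
    · ext1 J
      by_cases hJ : J = ∅
      · subst hJ
        rw [koszulD_apply, ← hc]
        refine Finset.sum_congr (by simp) fun j _ => ?_
        simp [mul_comm]
      · have hJ0 : J.card ≠ 0 := by simpa using hJ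
        rw [hw J hJ0, koszulD_apply]
        refine Finset.sum_eq_zero fun j hj => ?_
        have : ∑ k, (if insert j J = {k} then c k else 0) = 0 := by
          refine Finset.sum_eq_zero fun k _ => if_neg fun h => ?_
          have h1 := congrArg Finset.card h
          rw [Finset.card_insert_of_notMem (by simpa using hj), Finset.card_singleton] at h1
          omega
        rw [this, mul_zero]

lemma koszulPart_eq_bot {i : ℕ} (hi : n < i) : koszulPart K n i = ⊥ := by
  rw [eq_bot_iff]
  intro v hv
  ext1 L
  exact hv L (by have := L.card_le_univ; simp at this; omega)

lemma syzygy_eq_bot {i : ℕ} (hi : n < i) : syzygy K n i = ⊥ := by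
  rw [syzygy, koszulPart_eq_bot hi, Submodule.map_bot]

end KoszulComplex

section CodimensionBound

/-! ### The bound on the codimension -/

/-- The Koszul differential as a map from `Kᵢ` onto its image `Eᵢ`. -/
def koszulToSyzygy (K : Type*) [Field K] (n i : ℕ) :
    koszulPart K n i →ₗ[PolyRing K n] syzygy K n i :=
  (koszulD K n).restrict fun v hv => ⟨v, hv, rfl⟩

/-- The inclusion `Eᵢ₊₁ ⊆ Kᵢ`. -/
abbrev syzygyIncl (K : Type*) [Field K] (n i : ℕ) :
    syzygy K n (i + 1) →ₗ[PolyRing K n] koszulPart K n i :=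
  Submodule.inclusion (syzygy_succ_le_koszulPart i)

/-- The irrelevant maximal ideal `(x₁, …, xₙ)`. -/
abbrev varsIdeal (K : Type*) [Field K] (n : ℕ) : Ideal (PolyRing K n) :=
  Ideal.span (Set.range (MvPolynomial.X : Fin n → MvPolynomial (Fin n) K))

variable {K : Type u} [Field K] {n : ℕ}

lemma koszulToSyzygy_surjective (i : ℕ) : Function.Surjective (koszulToSyzygy K n i) := by
  rintro ⟨_, v, hv, rfl⟩
  exact ⟨⟨v, hv⟩, rfl⟩

lemma syzygyIncl_injective (i : ℕ) : Function.Injective (syzygyIncl K n i) :=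
  Submodule.inclusion_injective _

lemma exact_syzygyIncl_koszulToSyzygy {i : ℕ} (hi : i ≠ 0) :
    Function.Exact (syzygyIncl K n i) (koszulToSyzygy K n i) := by
  rintro ⟨w, hw⟩
  constructor
  · intro h
    have h0 : koszulD K n w = 0 := congrArg Subtype.val h
    exact ⟨⟨w, (mem_syzygy_succ_iff hi).mpr ⟨hw, h0⟩⟩, rfl⟩
  · rintro ⟨⟨v, hv⟩, h⟩
    have hvw : v = w := congrArg Subtype.val h
    subst hvw
    exact Subtype.ext ((mem_syzygy_succ_iff hi).mp hv).2

variable {X : Type u} [AddCommGroup X] [Module (PolyRing K n) X]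

lemma extKilledBy_pi {R X : Type u} [CommRing R] [AddCommGroup X] [Module R X] {r : R} {i : ℕ}
    (h : ExtKilledBy r X R i) {ι : Type} [Fintype ι] [DecidableEq ι] :
    ExtKilledBy r X (ι → R) i :=
  h.of_sum_comp_eq_id Finset.univ (fun j => LinearMap.proj j)
    (fun j => LinearMap.single R (fun _ => R) j) fun x => by
      simpa using Finset.univ_sum_single x

/-- The projection of the Koszul complex onto `Kᵢ`. -/
def koszulProj (K : Type*) [Field K] (n i : ℕ) : Koszul K n →ₗ[PolyRing K n] koszulPart K n i where
  toFun v := ⟨fun L => if L.card = i then v L else 0, fun _ hL => if_neg hL⟩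
  map_add' v w := by
    apply Subtype.ext
    ext1 L
    by_cases h : L.card = i <;> simp [h]
  map_smul' r v := by
    apply Subtype.ext
    ext1 L
    by_cases h : L.card = i <;> simp [h]

lemma koszulProj_coe {i : ℕ} (v : koszulPart K n i) : koszulProj K n i v = v := by
  apply Subtype.ext
  ext1 L
  by_cases h : L.card = i
  · simp [koszulProj, h]
  · simp [koszulProj, h, v.2 L h]

lemma extKilledBy_koszulPart {i : ℕ} {r : PolyRing K n}
    (h : ExtKilledBy r X (PolyRing K n) i) (j : ℕ) : ExtKilledBy r X (koszulPart K n j) i :=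
  (extKilledBy_pi h).of_retract (koszulPart K n j).subtype (koszulProj K n j) koszulProj_coe

lemma ExtKilledBy.of_subsingleton {R X A : Type u} [CommRing R] [AddCommGroup X] [Module R X]
    [AddCommGroup A] [Module R A] [Subsingleton A] (r : R) (i : ℕ) : ExtKilledBy r X A i := by
  intro e
  have h0 : (0 : R) • CategoryTheory.CategoryStruct.id (ModuleCat.of R A) =
    CategoryTheory.CategoryStruct.id (ModuleCat.of R A) := by
    ext x
    exact Subsingleton.elim _ _
  have : e = (0 : R) • e := by
    rw [CategoryTheory.Abelian.Ext.smul_eq_comp_mk₀, h0,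
      CategoryTheory.Abelian.Ext.comp_mk₀_id]
  rw [this, zero_smul, smul_zero]

lemma extKilledBy_zero_of_smul_eq_zero {R X A : Type u} [CommRing R] [AddCommGroup X] [Module R X]
    [AddCommGroup A] [Module R A] {r : R} (hr : ∀ x : A, r • x = 0) : ExtKilledBy r X A 0 := by
  rw [extKilledBy_zero_iff]
  intro f
  ext x
  exact hr _

lemma varsIdeal_smul_mem_syzygy_one {r : PolyRing K n} (hr : r ∈ varsIdeal K n)
    {w : Koszul K n} (hw : w ∈ koszulPart K n 0) : r • w ∈ syzygy K n 1 :=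
  mem_syzygy_one_iff.mpr ⟨(koszulPart K n 0).smul_mem r hw, Ideal.mul_mem_right _ _ hr⟩

/-- The cokernel of `E₁ ⊆ K₀`, a copy of the residue field, is killed by the variables. -/
lemma varsIdeal_smul_coker {r : PolyRing K n} (hr : r ∈ varsIdeal K n)
    (x : koszulPart K n 0 ⧸ LinearMap.range (syzygyIncl K n 0)) : r • x = 0 := by
  obtain ⟨⟨w, hw⟩, rfl⟩ := Submodule.mkQ_surjective _ x
  rw [← map_smul]
  exact (Submodule.Quotient.mk_eq_zero _).mpr
    ⟨⟨r • w, varsIdeal_smul_mem_syzygy_one hr hw⟩, rfl⟩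

/-- If `X` has grade at least two, `Ext¹(X, E_{i+1})` is `Hom(X, Kᵢ/E_{i+1})`, and `Kᵢ/E_{i+1}`
is the residue field for `i = 0` and torsion free for `i ≥ 1`. -/
lemma extKilledBy_one_syzygy_succ (h1 : ExtKilledBy (1 : PolyRing K n) X (PolyRing K n) 1)
    {s : PolyRing K n} (hs : s ≠ 0) (hsX : ∀ x : X, s • x = 0) (i : ℕ) {r : PolyRing K n}
    (hr : r ∈ varsIdeal K n) : ExtKilledBy r X (syzygy K n (i + 1)) 1 := by
  rcases Nat.eq_zero_or_pos i with rfl | hi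
  · exact ExtKilledBy.left_of_right (syzygyIncl_injective 0)
      (LinearMap.exact_map_mkQ_range (syzygyIncl K n 0)) (Submodule.mkQ_surjective _)
      (extKilledBy_koszulPart h1 0) (extKilledBy_zero_of_smul_eq_zero (varsIdeal_smul_coker hr))
  · refine ExtKilledBy.of_one (ExtKilledBy.left_of_right (syzygyIncl_injective i)
      (exact_syzygyIncl_koszulToSyzygy hi.ne') (koszulToSyzygy_surjective i)
      (extKilledBy_koszulPart h1 i) (extKilledBy_zero_of_isSMulRegular hsX ?_)) r
    rw [isSMulRegular_iff_right_eq_zero_of_smul]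
    intro x hx
    apply Subtype.ext
    ext1 L
    have := congrFun (congrArg Subtype.val hx) L
    exact (mul_eq_zero.mp this).resolve_left hs

/-- `E_{n-1}` has projective dimension one, with resolution `0 → Kₙ → Kₙ₋₁ → E_{n-1} → 0`. -/
lemma extKilledBy_syzygy_sub_one (hn : 2 ≤ n) {i : ℕ}
    (h1 : ExtKilledBy (1 : PolyRing K n) X (PolyRing K n) i)
    (h2 : ExtKilledBy (1 : PolyRing K n) X (PolyRing K n) (i + 1)) :
    ExtKilledBy (1 : PolyRing K n) X (syzygy K n (n - 1)) i := by
  obtain ⟨m, rfl⟩ : ∃ m, n = m + 1 := ⟨n - 1, by omega⟩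
  have hbot : Subsingleton (syzygy K (m + 1) (m + 2)) := by
    rw [syzygy_eq_bot (by omega)]
    infer_instance
  have hlast : ExtKilledBy (1 : PolyRing K (m + 1)) X (syzygy K (m + 1) (m + 1)) (i + 1) := by
    refine ExtKilledBy.right_of_middle (syzygyIncl_injective (m + 1))
      (exact_syzygyIncl_koszulToSyzygy (by omega)) (koszulToSyzygy_surjective (m + 1))
      (ExtKilledBy.of_subsingleton _ _) (extKilledBy_koszulPart h2 _)
  exact ExtKilledBy.right_of_middle (syzygyIncl_injective m)
      (exact_syzygyIncl_koszulToSyzygy (by omega)) (koszulToSyzygy_surjective m) hlast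
      (extKilledBy_koszulPart h1 _)

lemma sub_C_mem_varsIdeal (f : PolyRing K n) :
    f - MvPolynomial.C (MvPolynomial.constantCoeff f) ∈ varsIdeal K n := by
  induction f using MvPolynomial.induction_on with
  | C a => simp
  | add p q hp hq =>
    convert! (varsIdeal K n).add_mem hp hq using 1
    simp only [map_add]
    ring
  | mul_X p j _ =>
    simp only [map_mul, MvPolynomial.constantCoeff_X, mul_zero, map_zero, sub_zero]
    exact Ideal.mul_mem_left _ _ (Ideal.subset_span ⟨j, rfl⟩)

lemma constantCoeff_of_mem_varsIdeal {f : PolyRing K n} (hf : f ∈ varsIdeal K n) :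
    MvPolynomial.constantCoeff f = 0 := by
  suffices varsIdeal K n ≤ RingHom.ker MvPolynomial.constantCoeff from this hf
  rw [Ideal.span_le]
  rintro _ ⟨j, rfl⟩
  simp [RingHom.mem_ker]

lemma eq_top_of_varsIdeal_lt {I : Ideal (PolyRing K n)} (h : varsIdeal K n ≤ I)
    (hne : I ≠ varsIdeal K n) : I = ⊤ := by
  obtain ⟨f, hfI, hf⟩ := Set.exists_of_ssubset
    (lt_of_le_of_ne h fun e => hne (SetLike.coe_injective e).symm)
  have h0 : MvPolynomial.constantCoeff f ≠ 0 := fun h0 => hf (by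
    simpa [h0] using sub_C_mem_varsIdeal f)
  have h1 : MvPolynomial.C (MvPolynomial.constantCoeff f) ∈ I := by
    simpa using I.sub_mem hfI (h (sub_C_mem_varsIdeal f))
  exact Ideal.eq_top_of_isUnit_mem _ h1 (h0.isUnit.map MvPolynomial.C)

instance varsIdeal_isMaximal : (varsIdeal K n).IsMaximal := by
  refine ⟨⟨fun h => ?_, fun J hJ => eq_top_of_varsIdeal_lt hJ.le hJ.ne'⟩⟩
  have h1 : (1 : PolyRing K n) ∈ varsIdeal K n := h ▸ Submodule.mem_top
  simpa using constantCoeff_of_mem_varsIdeal h1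

/-- The residue field has grade `n`. -/
lemma extKilledBy_one_residueField {i : ℕ} (hi : i < n) :
    ExtKilledBy (1 : PolyRing K n) (PolyRing K n ⧸ varsIdeal K n) (PolyRing K n) i := by
  obtain ⟨rs, hlen, hmem, hreg⟩ := exists_isWeaklyRegular_of_isMaximal K n (varsIdeal K n)
  refine extKilledBy_of_isWeaklyRegular rs hreg (fun r hr x => ?_) i (hi.trans_eq hlen.symm)
  obtain ⟨x, rfl⟩ := Ideal.Quotient.mk_surjective x
  exact Ideal.Quotient.eq_zero_iff_mem.mpr (Ideal.mul_mem_right _ _ (hmem r hr))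

/-- `Extⁱ(S/𝔪, Eᵢ) ≠ 0`: the Koszul complex shifts it down to `Hom(S/𝔪, S/𝔪) ≠ 0`. -/
lemma not_extKilledBy_residueField_syzygy {i : ℕ} (hi : i < n) :
    ¬ ExtKilledBy (1 : PolyRing K n) (PolyRing K n ⧸ varsIdeal K n) (syzygy K n (i + 1))
      (i + 1) := by
  induction i with
  | zero =>
    intro h
    have h0 := ExtKilledBy.right_of_left (syzygyIncl_injective 0)
      (LinearMap.exact_map_mkQ_range (syzygyIncl K n 0)) (Submodule.mkQ_surjective _)
      (extKilledBy_koszulPart (extKilledBy_one_residueField hi) 0) h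
    rw [extKilledBy_zero_iff] at h0
    let e : koszulPart K n 0 := ⟨fun L => if L = ∅ then 1 else 0, fun L hL => if_neg (by
      rintro rfl
      exact hL rfl)⟩
    let φ : (PolyRing K n ⧸ varsIdeal K n) →ₗ[PolyRing K n]
        (koszulPart K n 0 ⧸ LinearMap.range (syzygyIncl K n 0)) :=
      (varsIdeal K n).liftQ (LinearMap.toSpanSingleton _ _ (Submodule.Quotient.mk e))
        fun r hr => varsIdeal_smul_coker hr _
    have h1 : φ (Ideal.Quotient.mk _ 1) = Submodule.Quotient.mk e :=
      one_smul (PolyRing K n)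
        (Submodule.Quotient.mk e : koszulPart K n 0 ⧸ LinearMap.range (syzygyIncl K n 0))
    have h2 := LinearMap.congr_fun (h0 φ) (Ideal.Quotient.mk _ 1)
    rw [one_smul, h1] at h2
    obtain ⟨⟨w, hw⟩, hwe⟩ := (Submodule.Quotient.mk_eq_zero _).mp h2
    have hwe' : w = fun L => if L = ∅ then 1 else 0 := congrArg Subtype.val hwe
    have h3 := (mem_syzygy_one_iff.mp hw).2
    rw [hwe'] at h3
    have h4 : MvPolynomial.constantCoeff (1 : PolyRing K n) = 0 :=
      constantCoeff_of_mem_varsIdeal h3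
    simp at h4
  | succ i ih =>
    intro h
    exact ih (by omega) (ExtKilledBy.right_of_left (syzygyIncl_injective (i + 1))
      (exact_syzygyIncl_koszulToSyzygy (by omega)) (koszulToSyzygy_surjective (i + 1))
      (extKilledBy_koszulPart (extKilledBy_one_residueField hi) _) h)

section Sequence

variable {t p q : ℕ} {I : Ideal (PolyRing K n)}
  {f : (Fin p → PolyRing K n) →ₗ[PolyRing K n] (Fin q → PolyRing K n)}
  {g : (Fin q → PolyRing K n) →ₗ[PolyRing K n] syzygy K n (t + 1) × syzygy K n (n - 1)}
  {φ : (syzygy K n (t + 1) × syzygy K n (n - 1)) →ₗ[PolyRing K n] I}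
  (hf : Function.Injective f) (hfg : Function.Exact f g)

include hf hfg in
/-- The image of `g` has projective dimension at most one. -/
lemma extKilledBy_range {i : ℕ} (h1 : ExtKilledBy (1 : PolyRing K n) X (PolyRing K n) i)
    (h2 : ExtKilledBy (1 : PolyRing K n) X (PolyRing K n) (i + 1)) :
    ExtKilledBy (1 : PolyRing K n) X (LinearMap.range g) i := by
  refine ExtKilledBy.right_of_middle hf (g := g.rangeRestrict) ?_ g.surjective_rangeRestrict
    (extKilledBy_pi h2) (extKilledBy_pi h1)
  intro x
  rw [← hfg x]
  exact Subtype.ext_iff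

variable (hgφ : Function.Exact g φ) (hφ : Function.Surjective φ)

include hf hfg hgφ hφ in
/-- If `I` has grade at least four, then `Hom(S/I, S/I)` embeds into a quotient of
`Ext¹(S/I, E_{t+1})`, so `𝔪` kills `S/I`. -/
lemma varsIdeal_le_of_three_lt_height (hn : 2 ≤ n) (hI : 3 < I.height) : varsIdeal K n ≤ I := by
  intro r hr
  have hgr : ∀ i : ℕ, i ≤ 3 → ExtKilledBy (1 : PolyRing K n) (PolyRing K n ⧸ I)
      (PolyRing K n) i := by
    intro i hi
    refine extKilledBy_one_of_lt_height I i (lt_of_le_of_lt (by exact_mod_cast hi) hI) _ ?_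
    intro r hr x
    obtain ⟨x, rfl⟩ := Ideal.Quotient.mk_surjective x
    exact Ideal.Quotient.eq_zero_iff_mem.mpr (Ideal.mul_mem_right _ _ hr)
  obtain ⟨s, hs, hs0⟩ : ∃ s ∈ I, s ≠ 0 := by
    refine Submodule.exists_mem_ne_zero_of_ne_bot ?_
    rintro rfl
    simp at hI
  have hsX : ∀ x : PolyRing K n ⧸ I, s • x = 0 := by
    intro x
    obtain ⟨x, rfl⟩ := Ideal.Quotient.mk_surjective x
    exact Ideal.Quotient.eq_zero_iff_mem.mpr (Ideal.mul_mem_right _ _ hs)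
  have hM : ExtKilledBy r (PolyRing K n ⧸ I) (syzygy K n (t + 1) × syzygy K n (n - 1)) 1 :=
    ExtKilledBy.middle_of_left (LinearMap.inl_injective (R := PolyRing K n))
      (Function.Exact.inl_snd (R := PolyRing K n)) (LinearMap.snd_surjective (R := PolyRing K n))
      (extKilledBy_syzygy_sub_one hn (hgr 1 (by norm_num)) (hgr 2 (by norm_num)))
      (extKilledBy_one_syzygy_succ (hgr 1 (by norm_num)) hs0 hsX t hr)
  have hI1 : ExtKilledBy r (PolyRing K n ⧸ I) I 1 :=
    ExtKilledBy.right_of_middle (f := (LinearMap.range g).subtype) Subtype.val_injective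
      (by rw [LinearMap.exact_iff, Submodule.range_subtype, ← LinearMap.exact_iff]; exact hgφ)
      hφ (extKilledBy_range hf hfg (hgr 2 (by norm_num)) (hgr 3 (by norm_num))) hM
  have h0 : ExtKilledBy r (PolyRing K n ⧸ I) (PolyRing K n ⧸ I) 0 :=
    ExtKilledBy.right_of_left (f := I.subtype) (g := I.mkQ) Subtype.val_injective
      (by rw [LinearMap.exact_iff]; simp) I.mkQ_surjective (hgr 0 (by norm_num)) hI1
  rw [extKilledBy_zero_iff] at h0
  have h1 := LinearMap.congr_fun (h0 LinearMap.id) (Ideal.Quotient.mk I 1)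
  rw [← Ideal.Quotient.eq_zero_iff_mem, ← mul_one r]
  exact h1

include hf hfg hgφ hφ in
/-- If `I = S`, then `Ext^{t+1}(S/𝔪, -)` vanishes on `I` and, because `t + 2 < n`, on the image of
`g`. So it vanishes on `E_{t+1}`, which is absurd. -/
lemma ideal_ne_top (ht : t + 3 ≤ n) : I ≠ ⊤ := by
  intro hI
  refine not_extKilledBy_residueField_syzygy (K := K) (n := n) (i := t) (by omega) ?_
  have hIS : ExtKilledBy (1 : PolyRing K n) (PolyRing K n ⧸ varsIdeal K n) I (t + 1) := by
    refine (extKilledBy_one_residueField (by omega)).of_retract I.subtype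
      (LinearMap.codRestrict I LinearMap.id fun x => hI ▸ Submodule.mem_top) fun x => ?_
    rfl
  have hM : ExtKilledBy (1 : PolyRing K n) (PolyRing K n ⧸ varsIdeal K n)
      (syzygy K n (t + 1) × syzygy K n (n - 1)) (t + 1) :=
    ExtKilledBy.middle_of_left (f := (LinearMap.range g).subtype) Subtype.val_injective
      (by rw [LinearMap.exact_iff, Submodule.range_subtype, ← LinearMap.exact_iff]; exact hgφ)
      hφ hIS (extKilledBy_range hf hfg (extKilledBy_one_residueField (by omega))
        (extKilledBy_one_residueField (by omega)))
  exact hM.of_retract (LinearMap.inl _ _ _) (LinearMap.fst _ _ _) fun x => rfl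

include hf hfg hgφ hφ in
lemma height_le_three (hn : 2 ≤ n) (ht : t + 3 ≤ n) (hI : I ≠ varsIdeal K n) :
    I.height ≤ 3 := by
  by_contra h
  exact ideal_ne_top hf hfg hgφ hφ ht (eq_top_of_varsIdeal_lt
    (varsIdeal_le_of_three_lt_height hf hfg hgφ hφ hn (not_le.mp h)) hI)

end Sequence

end CodimensionBound

section Dimension

/-! ### Height and independent variables -/

open MvPolynomial

lemma height_of_isMaximal_fin (F : Type*) [Field F] (n : ℕ) :
    ∀ (P : Ideal (MvPolynomial (Fin n) F)) [P.IsMaximal], P.height = n := by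
  induction n with
  | zero =>
    intro P hP
    have h1 := Ideal.height_le_ringKrullDim_of_ne_top hP.ne_top
    rw [MvPolynomial.ringKrullDim_of_isNoetherianRing, ringKrullDim_eq_zero_of_field] at h1
    simp only [Nat.card_eq_fintype_card, Fintype.card_fin, Nat.cast_zero, zero_add] at h1
    have h2 : P.height ≤ 0 := by exact_mod_cast h1
    simpa using h2
  | succ n ih =>
    intro P hP
    let e := (MvPolynomial.finSuccEquiv F n).toRingEquiv
    let Q : Ideal (Polynomial (MvPolynomial (Fin n) F)) := P.comap e.symm
    have hQ : Q.IsMaximal := Ideal.comap_isMaximal_of_equiv e.symm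
    have h0 : (Q.comap Polynomial.C).IsMaximal :=
      Polynomial.isMaximal_comap_C_of_isJacobsonRing Q
    have h1 : Q.height = P.height := RingEquiv.height_comap e.symm P
    have : Q.LiesOver (Q.comap Polynomial.C) := ⟨rfl⟩
    rw [← h1, Polynomial.height_eq_height_add_one (Q.comap Polynomial.C) Q, ih]
    push_cast
    rfl

/-- Every maximal ideal of a polynomial ring in `r` variables over a field has height `r`. -/
lemma height_of_isMaximal {σ F : Type*} [Finite σ] [Field F] (P : Ideal (MvPolynomial σ F))
    [P.IsMaximal] : P.height = Nat.card σ := by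
  let e := (MvPolynomial.renameEquiv F (Finite.equivFin σ)).toRingEquiv
  have hQ : (P.comap e.symm).IsMaximal := Ideal.comap_isMaximal_of_equiv e.symm
  rw [← RingEquiv.height_comap e.symm P, height_of_isMaximal_fin]

attribute [local instance] MvPolynomial.algebraMvPolynomial

variable {K : Type*} [Field K]

section

variable {σ τ : Type*} [Finite σ] [Finite τ]

/-- A prime `P` of `K[y][z]` meeting `K[y]` trivially keeps its height over the field `K(y)`, so
this height is at most the number of variables `z`. Equality holds if all `z_j` are algebraic over
`K(y)` modulo `P`, since then `P` becomes maximal. -/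
lemma height_le_of_comap_C_eq_bot (P : Ideal (MvPolynomial σ (MvPolynomial τ K))) [hP : P.IsPrime]
    (h : ∀ r, C r ∈ P → r = 0) : P.height ≤ Nat.card σ ∧
      ((∀ j, ∃ f : Polynomial (MvPolynomial τ K), f ≠ 0 ∧ Polynomial.aeval (X j) f ∈ P) →
        P.height = Nat.card σ) := by
  let L := FractionRing (MvPolynomial τ K)
  let M := (nonZeroDivisors (MvPolynomial τ K)).map (C (σ := σ))
  have hdisj : Disjoint (M : Set (MvPolynomial σ (MvPolynomial τ K))) P := by
    refine Set.disjoint_left.mpr ?_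
    rintro _ ⟨r, hr, rfl⟩ hrP
    exact nonZeroDivisors.ne_zero hr (h r hrP)
  let P' := P.map (algebraMap _ (MvPolynomial σ L))
  have hP' : P'.IsPrime := IsLocalization.isPrime_of_isPrime_disjoint M _ P hP hdisj
  have hheight : P'.height = P.height := IsLocalization.height_map_of_disjoint M P hdisj
  constructor
  · rw [← hheight]
    have h1 := Ideal.height_le_ringKrullDim_of_ne_top hP'.ne_top
    rw [MvPolynomial.ringKrullDim_of_isNoetherianRing, ringKrullDim_eq_zero_of_field,
      zero_add] at h1
    exact_mod_cast h1
  · intro hX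
    rw [← hheight]
    have hint : Algebra.IsIntegral L (MvPolynomial σ L ⧸ P') := by
      have htop : (⊤ : Subalgebra L (MvPolynomial σ L)) ≤
          (integralClosure L (MvPolynomial σ L ⧸ P')).comap (Ideal.Quotient.mkₐ L P') := by
        rw [← MvPolynomial.adjoin_range_X, Algebra.adjoin_le_iff]
        rintro _ ⟨j, rfl⟩
        obtain ⟨f, hf0, hf⟩ := hX j
        refine IsAlgebraic.isIntegral ⟨f.map (algebraMap _ L), ?_, ?_⟩
        · rwa [Polynomial.map_ne_zero_iff (IsFractionRing.injective _ _)]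
        · change Polynomial.aeval (Ideal.Quotient.mkₐ L P' (X j)) _ = 0
          rw [Polynomial.aeval_algHom_apply]
          refine Ideal.Quotient.eq_zero_iff_mem.mpr ?_
          have h2 := Ideal.mem_map_of_mem (algebraMap _ (MvPolynomial σ L)) hf
          convert! h2 using 1
          rw [Polynomial.aeval_map_algebraMap, ← Polynomial.aeval_algebraMap_apply]
          congr 2
          exact (MvPolynomial.map_X (algebraMap (MvPolynomial τ K) L) j).symm
      refine ⟨fun x => ?_⟩
      obtain ⟨x, rfl⟩ := Ideal.Quotient.mk_surjective x
      exact htop (x := x) trivial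
    have : P'.IsMaximal := by
      apply Ideal.Quotient.maximal_of_isField
      exact isField_of_isIntegral_of_isField' (R := L) (S := MvPolynomial σ L ⧸ P')
        (Field.toIsField L)
    exact height_of_isMaximal P'

end

variable {n : ℕ}

/-- `K[x₁, …, xₙ]` as a polynomial ring over `K[x_j : j ∈ T]`. -/
def splitVars (K : Type*) [Field K] {n : ℕ} (T : Finset (Fin n)) :
    MvPolynomial (Fin n) K ≃ₐ[K]
      MvPolynomial {j // j ∉ T} (MvPolynomial {j // j ∈ T} K) :=
  (renameEquiv K ((Equiv.sumCompl (· ∈ T)).symm.trans (Equiv.sumComm _ _))).trans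
    (sumAlgEquiv K _ _)

lemma splitVars_X_of_mem {T : Finset (Fin n)} (j : {j // j ∈ T}) :
    splitVars K T (X j.1) = C (X j) := by
  simp [splitVars, Equiv.sumCompl_symm_apply_of_pos j.2]

lemma splitVars_X_of_notMem {T : Finset (Fin n)} (j : {j // j ∉ T}) :
    splitVars K T (X j.1) = X j := by
  simp [splitVars, Equiv.sumCompl_symm_apply_of_neg j.2]

lemma splitVars_rename {T : Finset (Fin n)} (r : MvPolynomial {j // j ∈ T} K) :
    splitVars K T (rename Subtype.val r) = C r := by
  have : ((splitVars K T).toAlgHom.comp (rename Subtype.val)) =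
      IsScalarTower.toAlgHom K (MvPolynomial {j // j ∈ T} K)
        (MvPolynomial {j // j ∉ T} (MvPolynomial {j // j ∈ T} K)) := by
    ext j : 1
    simp [splitVars_X_of_mem, MvPolynomial.algebraMap_eq]
  exact DFunLike.congr_fun this r

/-- The variables `x_j`, `j ∈ T`, are algebraically independent modulo `I`. -/
def IndepVars (I : Ideal (MvPolynomial (Fin n) K)) (T : Finset (Fin n)) : Prop :=
  ∀ f ∈ I, f ∈ supported K (T : Set (Fin n)) → f = 0

lemma IndepVars.comap_C {P : Ideal (MvPolynomial (Fin n) K)} {T : Finset (Fin n)}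
    (h : IndepVars P T) (r : MvPolynomial {j // j ∈ T} K)
    (hr : C r ∈ P.comap (splitVars K T).symm.toRingEquiv) : r = 0 := by
  have h1 : (splitVars K T).symm (C r) = rename Subtype.val r := by
    rw [← splitVars_rename, AlgEquiv.symm_apply_apply]
  have h2 : rename Subtype.val r ∈ P := h1 ▸ hr
  have h3 := h _ h2 (by
    rw [supported_eq_range_rename]
    exact ⟨r, rfl⟩)
  exact rename_injective _ Subtype.val_injective (h3.trans (map_zero _).symm)

lemma IndepVars.height_add_card_le {P : Ideal (MvPolynomial (Fin n) K)} [P.IsPrime]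
    {T : Finset (Fin n)} (h : IndepVars P T) : P.height + T.card ≤ n := by
  let e := (splitVars K T).symm.toRingEquiv
  have hQ : (P.comap e).IsPrime := Ideal.comap_isPrime _ _
  have h1 := (height_le_of_comap_C_eq_bot (P.comap e) h.comap_C).1
  rw [RingEquiv.height_comap] at h1
  have h2 : Nat.card {j // j ∉ T} + T.card = n := by
    have := Fintype.card_subtype_compl (fun j => j ∈ T)
    simp only [Fintype.card_fin, Fintype.card_coe] at this
    have h3 := T.card_le_univ
    simp only [Fintype.card_fin] at h3
    rw [Nat.card_eq_fintype_card]
    omega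
  calc P.height + T.card ≤ (Nat.card {j // j ∉ T} : ℕ∞) + T.card := by gcongr
    _ = n := by exact_mod_cast h2

lemma IndepVars.height_add_card_eq {P : Ideal (MvPolynomial (Fin n) K)} [P.IsPrime]
    {T : Finset (Fin n)} (h : IndepVars P T) (hmax : ∀ j ∉ T, ¬ IndepVars P (insert j T)) :
    P.height + T.card = n := by
  let e := (splitVars K T).symm.toRingEquiv
  have hQ : (P.comap e).IsPrime := Ideal.comap_isPrime _ _
  have h1 := (height_le_of_comap_C_eq_bot (P.comap e) h.comap_C).2 ?_
  · rw [RingEquiv.height_comap] at h1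
    have h2 : Nat.card {j // j ∉ T} + T.card = n := by
      have := Fintype.card_subtype_compl (fun j => j ∈ T)
      simp only [Fintype.card_fin, Fintype.card_coe] at this
      have h3 := T.card_le_univ
      simp only [Fintype.card_fin] at h3
      rw [Nat.card_eq_fintype_card]
      omega
    rw [h1]
    exact_mod_cast h2
  · rintro ⟨j, hj⟩
    have := hmax j hj
    simp only [IndepVars, not_forall] at this
    obtain ⟨f, hfP, hf, hf0⟩ := this
    -- a polynomial in the variables `T ∪ {j}` is a univariate polynomial in `x_j` over `K[x_T]`
    have hrange : ∃ g : Polynomial (MvPolynomial {j // j ∈ T} K),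
        Polynomial.aeval (X ⟨j, hj⟩) g = splitVars K T f := by
      have hle : supported K ((insert j T : Finset (Fin n)) : Set (Fin n)) ≤
          (((Polynomial.aeval (R := MvPolynomial {j // j ∈ T} K)
            (X ⟨j, hj⟩ : MvPolynomial {j // j ∉ T} (MvPolynomial {j // j ∈ T} K))).range
              ).restrictScalars K).comap (splitVars K T).toAlgHom := by
        rw [supported, Algebra.adjoin_le_iff]
        rintro _ ⟨k, hk, rfl⟩
        rcases Finset.mem_insert.mp (Finset.mem_coe.mp hk) with rfl | hk
        · exact ⟨Polynomial.X, by
            simpa using (splitVars_X_of_notMem (K := K) ⟨k, hj⟩).symm⟩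
        · exact ⟨Polynomial.C (X ⟨k, hk⟩), by
            simpa [MvPolynomial.algebraMap_eq] using
              (splitVars_X_of_mem (K := K) ⟨k, hk⟩).symm⟩
      exact hle hf
    obtain ⟨g, hg⟩ := hrange
    refine ⟨g, ?_, ?_⟩
    · rintro rfl
      rw [map_zero, eq_comm, map_eq_zero_iff _ (splitVars K T).injective] at hg
      exact hf0 hg
    · rw [hg]
      change (splitVars K T).symm (splitVars K T f) ∈ P
      rwa [AlgEquiv.symm_apply_apply]

/-- Over an ideal of height more than `n - |T|` the variables in `T` are dependent. -/
lemma not_indepVars_of_lt_height {I : Ideal (MvPolynomial (Fin n) K)} {T : Finset (Fin n)}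
    (h : (n : ℕ∞) < I.height + T.card) : ¬ IndepVars I T := by
  intro hT
  -- `K[x_T] \ {0}` is disjoint from `I`, hence from some prime over `I`
  let M : Submonoid (MvPolynomial (Fin n) K) :=
    (nonZeroDivisors (supported K (T : Set (Fin n)))).map
      (supported K (T : Set (Fin n))).val
  have hdisj : Disjoint (I : Set (MvPolynomial (Fin n) K)) M := by
    refine Set.disjoint_left.mpr ?_
    rintro _ hI ⟨r, hr, rfl⟩
    exact nonZeroDivisors.ne_zero hr (Subtype.ext (hT _ hI r.2))
  obtain ⟨P, hP, hIP, hdP⟩ := Ideal.exists_le_prime_disjoint I M hdisj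
  have hTP : IndepVars P T := by
    intro f hf hfT
    by_contra hf0
    refine Set.disjoint_left.mp hdP hf ⟨⟨f, hfT⟩, ?_, rfl⟩
    exact mem_nonZeroDivisors_of_ne_zero fun h => hf0 (congrArg Subtype.val h)
  refine absurd (hTP.height_add_card_le) (not_le.mpr (lt_of_lt_of_le h ?_))
  gcongr

/-- Modulo an ideal of height `≤ h`, some `n - h` of the variables are independent. -/
lemma exists_indepVars_of_height_le {I : Ideal (MvPolynomial (Fin n) K)} {h : ℕ}
    (hI : I.height ≤ h) : ∃ T : Finset (Fin n), IndepVars I T ∧ n ≤ T.card + h := by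
  have hne : I ≠ ⊤ := by
    rintro rfl
    simp at hI
  obtain ⟨m, hm⟩ := ENat.ne_top_iff_exists.mp (ne_top_of_le_ne_top (ENat.natCast_ne_top h) hI)
  obtain ⟨P, hP, hPI, hPh⟩ := Ideal.exists_isPrime_height_eq hm.symm
  have hbot : IndepVars P ∅ := by
    intro f hf hf0
    rw [Finset.coe_empty, supported_empty] at hf0
    obtain ⟨c, rfl⟩ := Algebra.mem_bot.mp hf0
    by_contra hc
    have hc0 : c ≠ 0 := by
      rintro rfl
      exact hc (map_zero _)
    exact hP.ne_top (Ideal.eq_top_of_isUnit_mem _ hf (hc0.isUnit.map _))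
  obtain ⟨T, hT⟩ := (Set.toFinite {T : Finset (Fin n) | IndepVars P T}).exists_maximal ⟨∅, hbot⟩
  have hTP : IndepVars P T := hT.prop
  refine ⟨T, fun f hf => hTP f (hPI hf), ?_⟩
  have h1 := hTP.height_add_card_eq fun j hj hj' =>
    hj (hT.le_of_ge hj' (Finset.subset_insert j T) (Finset.mem_insert_self j T))
  have h2 : P.height ≤ h := hPh.trans_le (hm.trans_le hI)
  have h3 : (n : ℕ∞) ≤ h + T.card := by
    rw [← h1]
    gcongr
  have h4 : n ≤ h + T.card := by exact_mod_cast h3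
  omega

end Dimension

section HilbertFunction

/-! ### Growth of the Hilbert function -/

open MvPolynomial

variable {K : Type*} [Field K] {n : ℕ}

lemma homogPart_eq_restrictSupport (m : ℤ) :
    homogPart K n m = restrictSupport K {s | ((Finsupp.degree s : ℕ) : ℤ) = m} := by
  ext f
  rfl

lemma finite_setOf_degree_eq (m : ℤ) :
    {s : Fin n →₀ ℕ | ((Finsupp.degree s : ℕ) : ℤ) = m}.Finite := by
  refine (Finset.finite_toSet
    (Finset.finsuppAntidiag (Finset.univ : Finset (Fin n)) m.toNat)).subset fun s hs => ?_
  have hs' : ((Finsupp.degree s : ℕ) : ℤ) = m := hs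
  rw [Finset.mem_coe, Finset.mem_finsuppAntidiag, ← Finsupp.degree_eq_sum]
  exact ⟨by omega, Finset.subset_univ _⟩

lemma finrank_restrictSupport (s : Set (Fin n →₀ ℕ)) :
    Module.finrank K (restrictSupport K s) = s.ncard := by
  rw [Module.finrank_eq_nat_card_basis (basisRestrictSupport K s), Nat.card_coe_set_eq]

lemma finite_restrictSupport {s : Set (Fin n →₀ ℕ)} (hs : s.Finite) :
    Module.Finite K (restrictSupport K s) :=
  have := hs.to_subtype
  Module.Finite.of_basis (basisRestrictSupport K s)

instance finite_homogPart (m : ℤ) : Module.Finite K (homogPart K n m) := by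
  rw [homogPart_eq_restrictSupport]
  exact finite_restrictSupport (finite_setOf_degree_eq m)

/-- The dimension of the space of forms of degree `m` in `n` variables. -/
lemma finrank_homogPart (hn : 1 ≤ n) (m : ℕ) :
    Module.finrank K (homogPart K n m) = (m + (n - 1)).choose (n - 1) := by
  rw [homogPart_eq_restrictSupport, finrank_restrictSupport]
  have : {s : Fin n →₀ ℕ | ((Finsupp.degree s : ℕ) : ℤ) = m} =
      (Finset.finsuppAntidiag (Finset.univ : Finset (Fin n)) m : Set (Fin n →₀ ℕ)) := by
    ext s
    rw [Finset.mem_coe, Finset.mem_finsuppAntidiag, ← Finsupp.degree_eq_sum]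
    simp
  rw [this, Set.ncard_coe_finset, Finset.card_finsuppAntidiag_nat_eq_choose, Finset.card_univ,
    Fintype.card_fin]
  have h1 : n + m - 1 = m + (n - 1) := by omega
  rw [h1, ← Nat.choose_symm_add]

/-- The projection of `S` onto its homogeneous part of degree `m`. -/
def homogProj (K : Type*) [Field K] (n : ℕ) (m : ℤ) : PolyRing K n →ₗ[K] PolyRing K n :=
  if 0 ≤ m then homogeneousComponent m.toNat else 0

lemma coeff_homogProj (m : ℤ) (f : PolyRing K n) (s : Fin n →₀ ℕ) :
    (homogProj K n m f).coeff s = if ((Finsupp.degree s : ℕ) : ℤ) = m then f.coeff s else 0 := by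
  by_cases hm : 0 ≤ m
  · rw [homogProj, if_pos hm, coeff_homogeneousComponent]
    congr 1
    simp only [eq_iff_iff]
    omega
  · rw [homogProj, if_neg hm, if_neg (by omega)]
    simp

lemma mem_homogPart_iff {m : ℤ} {f : PolyRing K n} :
    f ∈ homogPart K n m ↔ ∀ s, f.coeff s ≠ 0 → ((Finsupp.degree s : ℕ) : ℤ) = m :=
  forall_congr' fun s => by rw [mem_support_iff]

lemma homogProj_mem (m : ℤ) (f : PolyRing K n) : homogProj K n m f ∈ homogPart K n m := by
  rw [mem_homogPart_iff]
  intro s hs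
  rw [coeff_homogProj] at hs
  by_contra h
  exact hs (if_neg h)

lemma homogProj_eq_self {m : ℤ} {f : PolyRing K n} (hf : f ∈ homogPart K n m) :
    homogProj K n m f = f := by
  ext s
  rw [coeff_homogProj]
  split_ifs with h
  · rfl
  · by_contra h0
    exact h (mem_homogPart_iff.mp hf s (Ne.symm h0))

lemma homogProj_eq_zero {m k : ℤ} (hmk : m ≠ k) {f : PolyRing K n} (hf : f ∈ homogPart K n k) :
    homogProj K n m f = 0 := by
  ext s
  rw [coeff_homogProj, coeff_zero]
  split_ifs with h
  · by_contra h0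
    exact hmk (h.symm.trans (mem_homogPart_iff.mp hf s h0))
  · rfl

lemma IsGradedIdeal.homogProj_mem {I : Ideal (PolyRing K n)} (hI : IsGradedIdeal I)
    {f : PolyRing K n} (hf : f ∈ I) (m : ℤ) : homogProj K n m f ∈ I := by
  rw [homogProj]
  split_ifs
  · exact homogeneousComponent_mem_of_mem hI hf _
  · exact I.zero_mem

/-- The number of exponents of degree `m` such that among any `r + 1` coordinates one is smaller
than `D` grows at most like `m ^ (r - 1)`: at most `r` coordinates are large, and one of those is
determined by the others and by the degree. -/
lemma exists_ncard_exponents_le {r : ℕ} (hr : 1 ≤ r) (hrn : r ≤ n) (D : ℕ) :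
    ∃ C : ℕ, ∀ (m : ℕ) (W : Set (Fin n →₀ ℕ)),
      (∀ s ∈ W, Finsupp.degree s = m ∧ ∀ T : Finset (Fin n), T.card = r + 1 → ∃ j ∈ T, s j < D) →
      W.ncard ≤ C * (m + 1) ^ (r - 1) := by
  classical
  let pairs : Finset (Finset (Fin n) × Fin n) :=
    Finset.univ.filter fun a => a.1.card = r ∧ a.2 ∈ a.1
  refine ⟨pairs.card * D ^ (n - r), fun m W hW => ?_⟩
  -- for `a = (A, j₀)` the exponent at `j₀` is dropped, and recovered from the degree by `decode a`
  let box (a : Finset (Fin n) × Fin n) : Finset (Fin n → ℕ) :=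
    Fintype.piFinset fun j => if j ∈ a.1 then (if j = a.2 then {0} else Finset.range (m + 1))
      else Finset.range D
  let decode (a : Finset (Fin n) × Fin n) (u : Fin n → ℕ) : Fin n →₀ ℕ :=
    Finsupp.equivFunOnFinite.symm (Function.update u a.2 (m - ∑ j, u j))
  have hbox : ∀ a ∈ pairs, (box a).card = (m + 1) ^ (r - 1) * D ^ (n - r) := by
    intro a ha
    obtain ⟨ha1, ha2⟩ := (Finset.mem_filter.mp ha).2
    rw [Fintype.card_piFinset, ← Finset.prod_mul_prod_compl a.1]
    congr 1
    · rw [← Finset.mul_prod_erase _ _ ha2, if_pos ha2, if_pos rfl, Finset.card_singleton, one_mul,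
        Finset.prod_congr rfl (g := fun _ => m + 1), Finset.prod_const,
        Finset.card_erase_of_mem ha2, ha1]
      intro j hj
      rw [if_pos (Finset.mem_of_mem_erase hj), if_neg (Finset.ne_of_mem_erase hj),
        Finset.card_range]
    · rw [Finset.prod_congr rfl (g := fun _ => D), Finset.prod_const, Finset.card_compl, ha1,
        Fintype.card_fin]
      intro j hj
      rw [if_neg (Finset.mem_compl.mp hj), Finset.card_range]
  have hsub : W ⊆ (pairs.biUnion fun a => (box a).image (decode a) : Finset (Fin n →₀ ℕ)) := by
    intro s hs
    obtain ⟨hdeg, hsmall⟩ := hW s hs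
    have hlarge : (Finset.univ.filter fun j => D ≤ s j).card ≤ r := by
      by_contra h
      obtain ⟨T, hT, hTc⟩ := Finset.exists_subset_card_eq (Nat.succ_le_of_lt (not_le.mp h))
      obtain ⟨j, hj, hjD⟩ := hsmall T hTc
      exact absurd (Finset.mem_filter.mp (hT hj)).2 (not_le.mpr hjD)
    obtain ⟨A, hA, -, hAc⟩ := Finset.exists_subsuperset_card_eq
      (Finset.subset_univ (Finset.univ.filter fun j => D ≤ s j)) hlarge (by simpa using hrn)
    obtain ⟨j₀, hj₀⟩ := Finset.card_pos.mp (hAc.symm ▸ hr : 0 < A.card)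
    have hsum : ∑ j, s j = m := by rw [← hdeg, Finsupp.degree_eq_sum]
    rw [Finset.mem_coe, Finset.mem_biUnion]
    refine ⟨(A, j₀), Finset.mem_filter.mpr ⟨Finset.mem_univ _, hAc, hj₀⟩, Finset.mem_image.mpr
      ⟨Function.update s j₀ 0, Fintype.mem_piFinset.mpr fun j => ?_, ?_⟩⟩
    · by_cases hjA : j ∈ A
      · by_cases hj : j = j₀
        · subst hj
          simp [hjA]
        · have : s j ≤ ∑ j, s j := Finset.single_le_sum (fun _ _ => Nat.zero_le _)
            (Finset.mem_univ j)
          simp only [hjA, hj, if_true, if_false, Function.update_of_ne hj, Finset.mem_range]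
          omega
      · have hj : j ≠ j₀ := by rintro rfl; exact hjA hj₀
        simp only [hjA, if_false, Function.update_of_ne hj, Finset.mem_range]
        by_contra h
        exact hjA (hA (Finset.mem_filter.mpr ⟨Finset.mem_univ _, not_lt.mp h⟩))
    · ext j
      simp only [decode, Finsupp.equivFunOnFinite_symm_apply_apply, Function.update_idem]
      by_cases hj : j = j₀
      · subst hj
        rw [Function.update_self]
        have h1 := Finset.add_sum_erase Finset.univ (fun j => s j) (Finset.mem_univ j)
        have h2 := Finset.add_sum_erase Finset.univ (Function.update s j 0) (Finset.mem_univ j)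
        rw [Function.update_self, Finset.sum_congr rfl (g := fun j => s j)
          fun k hk => Function.update_of_ne (Finset.ne_of_mem_erase hk) _ _] at h2
        omega
      · rw [Function.update_of_ne hj]
  calc W.ncard ≤ (pairs.biUnion fun a => (box a).image (decode a)).card := by
        rw [← Set.ncard_coe_finset]
        exact Set.ncard_le_ncard hsub (Finset.finite_toSet _)
    _ ≤ pairs.card * ((m + 1) ^ (r - 1) * D ^ (n - r)) :=
        Finset.card_biUnion_le_card_mul _ _ _ fun a ha =>
          Finset.card_image_le.trans (hbox a ha).le
    _ = pairs.card * D ^ (n - r) * (m + 1) ^ (r - 1) := by ring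

/-- If any `r + 1` of the variables are dependent modulo the graded ideal `I`, the Hilbert function
of `S/I` grows at most like `m ^ (r - 1)`: the leading monomial of a relation among the variables
in `T` involves only the variables in `T`, and monomials not divisible by these leading monomials
span `S/I`. -/
lemma exists_finrank_homogPart_le {I : Ideal (PolyRing K n)} (hI : IsGradedIdeal I) {r : ℕ}
    (hr : 1 ≤ r) (hrn : r ≤ n) (h : ∀ T : Finset (Fin n), T.card = r + 1 → ¬ IndepVars I T) :
    ∃ C : ℕ, ∀ m : ℕ, Module.finrank K (homogPart K n m) ≤
      Module.finrank K (homogPart K n m ⊓ I.restrictScalars K : Submodule K (PolyRing K n)) +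
        C * (m + 1) ^ (r - 1) := by
  classical
  have h' : ∀ T : {T : Finset (Fin n) // T.card = r + 1},
      ∃ f ∈ I, f ∈ supported K (T.1 : Set (Fin n)) ∧ f ≠ 0 := by
    intro T
    have := h T.1 T.2
    simp only [IndepVars, not_forall] at this
    obtain ⟨f, h1, h2, h3⟩ := this
    exact ⟨f, h1, h2, h3⟩
  choose F hFI hFT hF0 using h'
  let o : MonomialOrder (Fin n) := MonomialOrder.lex
  have hunit : ∀ T, IsUnit (o.leadingCoeff (F T)) := fun T =>
    (o.leadingCoeff_ne_zero_iff.mpr (hF0 T)).isUnit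
  let D := (Finset.univ.sup fun T => Finset.univ.sup fun j => o.degree (F T) j) + 1
  have hD : ∀ T j, o.degree (F T) j < D := fun T j => Nat.lt_succ_of_le
    ((Finset.le_sup (f := fun j => o.degree (F T) j) (Finset.mem_univ j)).trans
      (Finset.le_sup (f := fun T => Finset.univ.sup fun j => o.degree (F T) j)
        (Finset.mem_univ T)))
  obtain ⟨C, hC⟩ := exists_ncard_exponents_le hr hrn D
  refine ⟨C, fun m => ?_⟩
  let W : Set (Fin n →₀ ℕ) := {s | Finsupp.degree s = m ∧ ∀ T, ¬ o.degree (F T) ≤ s}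
  have hWfin : W.Finite := (finite_setOf_degree_eq (m : ℤ)).subset fun s hs =>
    congrArg Nat.cast hs.1
  have hWcard : W.ncard ≤ C * (m + 1) ^ (r - 1) := by
    refine hC m W fun s hs => ⟨hs.1, fun T hT => ?_⟩
    have h1 := hs.2 ⟨T, hT⟩
    rw [Finsupp.le_def] at h1
    push Not at h1
    obtain ⟨j, hj⟩ := h1
    refine ⟨j, ?_, hj.trans (hD _ _)⟩
    have h2 : o.degree (F ⟨T, hT⟩) ∈ (F ⟨T, hT⟩).support := o.degree_mem_support (hF0 _)
    refine Finset.mem_coe.mp (mem_supported.mp (hFT ⟨T, hT⟩) ?_)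
    rw [Finset.mem_coe, mem_vars_iff_mem_support]
    exact ⟨_, h2, Finsupp.mem_support_iff.mpr (by omega)⟩
  have := finite_restrictSupport (K := K) hWfin
  have hle : homogPart K n m ≤ (homogPart K n m ⊓ I.restrictScalars K) ⊔ restrictSupport K W := by
    intro f hf
    obtain ⟨g, ρ, hfg, -, hρ⟩ := o.div hunit f
    have hgI : Finsupp.linearCombination (PolyRing K n) F g ∈ I :=
      I.sum_mem fun T _ => I.mul_mem_left _ (hFI T)
    rw [Submodule.mem_sup]
    refine ⟨homogProj K n m (Finsupp.linearCombination (PolyRing K n) F g),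
      ⟨homogProj_mem _ _, hI.homogProj_mem hgI m⟩, homogProj K n m ρ, ?_, ?_⟩
    · rw [mem_restrictSupport_iff]
      intro s hs
      rw [Finset.mem_coe, mem_support_iff, coeff_homogProj] at hs
      have h1 : ((Finsupp.degree s : ℕ) : ℤ) = m := by
        by_contra h
        exact hs (if_neg h)
      rw [if_pos h1] at hs
      exact ⟨by exact_mod_cast h1, hρ s (mem_support_iff.mpr hs)⟩
    · rw [← map_add, ← hfg, homogProj_eq_self hf]
  have hfin1 : Module.Finite K
      (homogPart K n m ⊓ I.restrictScalars K : Submodule K (PolyRing K n)) :=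
    Submodule.finiteDimensional_of_le inf_le_left
  calc Module.finrank K (homogPart K n m)
      ≤ Module.finrank K ((homogPart K n m ⊓ I.restrictScalars K) ⊔ restrictSupport K W :
          Submodule K (PolyRing K n)) := Submodule.finrank_mono hle
    _ ≤ _ := Submodule.finrank_add_le_finrank_add_finrank _ _
    _ ≤ _ := by
      rw [finrank_restrictSupport]
      gcongr

/-- If the variables in `T` are independent modulo `I`, the Hilbert function of `S/I` grows at
least like `m ^ (|T| - 1)`, since there are that many monomials in the variables of `T`. -/
lemma pow_le_finrank_homogPart_sub {I : Ideal (PolyRing K n)} {T : Finset (Fin n)}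
    (hT : IndepVars I T) (hT1 : 1 ≤ T.card) {m k : ℕ} (hkm : n * k ≤ m) :
    (k + 1) ^ (T.card - 1) + Module.finrank K
      (homogPart K n m ⊓ I.restrictScalars K : Submodule K (PolyRing K n)) ≤
      Module.finrank K (homogPart K n m) := by
  classical
  obtain ⟨j₀, hj₀⟩ := Finset.card_pos.mp hT1
  -- exponents `≤ k` on `T ∖ {j₀}`; `decode` fills up the degree to `m` in the coordinate `j₀`
  let box : Finset (Fin n → ℕ) := Fintype.piFinset fun j =>
    if j ∈ T.erase j₀ then Finset.range (k + 1) else {0}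
  let decode (u : Fin n → ℕ) : Fin n →₀ ℕ :=
    Finsupp.equivFunOnFinite.symm (Function.update u j₀ (m - ∑ j, u j))
  have hbox : box.card = (k + 1) ^ (T.card - 1) := by
    rw [Fintype.card_piFinset, ← Finset.prod_mul_prod_compl (T.erase j₀),
      Finset.prod_congr rfl (g := fun _ => k + 1), Finset.prod_const,
      Finset.card_erase_of_mem hj₀, Finset.prod_congr rfl (g := fun _ => 1),
      Finset.prod_const_one, mul_one]
    · intro j hj
      rw [if_neg (Finset.mem_compl.mp hj), Finset.card_singleton]
    · intro j hj
      rw [if_pos hj, Finset.card_range]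
  have hmem : ∀ u ∈ box, (∀ j, u j ≤ k) ∧ ∀ j ∉ T.erase j₀, u j = 0 := by
    intro u hu
    rw [Fintype.mem_piFinset] at hu
    refine ⟨fun j => ?_, fun j hj => ?_⟩
    · have := hu j
      split_ifs at this with h
      · exact Nat.lt_succ_iff.mp (Finset.mem_range.mp this)
      · rw [Finset.mem_singleton.mp this]; exact Nat.zero_le _
    · have := hu j
      rw [if_neg hj] at this
      exact Finset.mem_singleton.mp this
  let W : Set (Fin n →₀ ℕ) := (box.image decode : Finset (Fin n →₀ ℕ))
  have hWcard : W.ncard = (k + 1) ^ (T.card - 1) := by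
    rw [Set.ncard_coe_finset, Finset.card_image_of_injOn, hbox]
    intro u hu v hv huv
    funext j
    by_cases hj : j = j₀
    · subst hj
      rw [(hmem u hu).2 j (by simp), (hmem v hv).2 j (by simp)]
    · have := DFunLike.congr_fun huv j
      simpa [decode, Function.update_of_ne hj] using this
  have hWdeg : ∀ s ∈ W, Finsupp.degree s = m := by
    intro s hs
    obtain ⟨u, hu, rfl⟩ := Finset.mem_image.mp (Finset.mem_coe.mp hs)
    have h1 : ∑ j, u j ≤ m := calc
      ∑ j, u j ≤ ∑ _j : Fin n, k := Finset.sum_le_sum fun j _ => (hmem u hu).1 j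
      _ ≤ m := by simpa using hkm
    have h2 := Finset.add_sum_erase Finset.univ u (Finset.mem_univ j₀)
    rw [(hmem u hu).2 j₀ (by simp)] at h2
    rw [Finsupp.degree_eq_sum, ← Finset.add_sum_erase Finset.univ _ (Finset.mem_univ j₀)]
    have h3 : ∑ j ∈ Finset.univ.erase j₀, decode u j = ∑ j ∈ Finset.univ.erase j₀, u j :=
      Finset.sum_congr rfl fun j hj => by
        simp [decode, Function.update_of_ne (Finset.ne_of_mem_erase hj)]
    rw [h3]
    simp only [decode, Finsupp.equivFunOnFinite_symm_apply_apply, Function.update_self]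
    omega
  have hWsupp : ∀ s ∈ W, ∀ j, s j ≠ 0 → j ∈ T := by
    intro s hs j hj
    obtain ⟨u, hu, rfl⟩ := Finset.mem_image.mp (Finset.mem_coe.mp hs)
    by_cases hjj : j = j₀
    · exact hjj ▸ hj₀
    · by_contra hjT
      refine hj ?_
      simp only [decode, Finsupp.equivFunOnFinite_symm_apply_apply, Function.update_of_ne hjj]
      exact (hmem u hu).2 j fun h => hjT (Finset.mem_of_mem_erase h)
  have hWle : restrictSupport K W ≤ homogPart K n m := by
    rw [homogPart_eq_restrictSupport]
    exact restrictSupport_mono K fun s hs => congrArg Nat.cast (hWdeg s hs)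
  have hdisj : restrictSupport K W ⊓ (homogPart K n m ⊓ I.restrictScalars K) = ⊥ := by
    rw [eq_bot_iff]
    rintro f ⟨hf, -, hfI⟩
    refine hT f hfI ?_
    rw [mem_supported]
    intro j hj
    rw [Finset.mem_coe, mem_vars_iff_mem_support] at hj
    obtain ⟨s, hs, hsj⟩ := hj
    exact hWsupp s (hf hs) j (Finsupp.mem_support_iff.mp hsj)
  have hfin1 : Module.Finite K
      (homogPart K n m ⊓ I.restrictScalars K : Submodule K (PolyRing K n)) :=
    Submodule.finiteDimensional_of_le inf_le_left
  have hfin2 : Module.Finite K (restrictSupport K W) := Submodule.finiteDimensional_of_le hWle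
  have h1 := Submodule.finrank_sup_add_finrank_inf_eq (restrictSupport K W)
    (homogPart K n m ⊓ I.restrictScalars K)
  rw [hdisj, finrank_bot, add_zero, finrank_restrictSupport, hWcard] at h1
  rw [← h1]
  exact Submodule.finrank_mono (sup_le hWle inf_le_left)

end HilbertFunction

section GradedPieces

/-! ### Graded vector spaces and dimension counts -/

/-- The subspaces `𝒜 m` form a grading of the vector space `M`. This is expressed through the
projections `π m` onto `𝒜 m`: every element is the sum of its projections, of which only finitely
many are nonzero. -/
def IsGrading {K M : Type*} [Field K] [AddCommGroup M] [Module K M] (𝒜 : ℤ → Submodule K M)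
    (π : ℤ → M →ₗ[K] M) : Prop :=
  (∀ m x, π m x ∈ 𝒜 m) ∧ (∀ m, ∀ x ∈ 𝒜 m, π m x = x) ∧
    (∀ m k, m ≠ k → ∀ x ∈ 𝒜 k, π m x = 0) ∧
    ∀ x, ∃ s₀ : Finset ℤ, ∀ s, s₀ ⊆ s → ∑ m ∈ s, π m x = x

section

variable {K M N : Type*} [Field K] [AddCommGroup M] [Module K M] [AddCommGroup N] [Module K N]
  {𝒜 : ℤ → Submodule K M} {ℬ : ℤ → Submodule K N} {π : ℤ → M →ₗ[K] M} {ρ : ℤ → N →ₗ[K] N}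

/-- A map that respects gradings commutes with the projections. -/
lemma IsGrading.map_proj (hπ : IsGrading 𝒜 π) (hρ : IsGrading ℬ ρ) (f : M →ₗ[K] N)
    (hf : ∀ m, ∀ x ∈ 𝒜 m, f x ∈ ℬ m) (m : ℤ) (x : M) : f (π m x) = ρ m (f x) := by
  classical
  obtain ⟨s, hs⟩ := hπ.2.2.2 x
  have hx := hs (insert m s) (Finset.subset_insert _ _)
  conv_rhs => rw [← hx, map_sum, map_sum]
  rw [Finset.sum_eq_single_of_mem m (Finset.mem_insert_self _ _)]
  · exact (hρ.2.1 m _ (hf m _ (hπ.1 m x))).symm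
  · exact fun k _ hk => hρ.2.2.1 m k hk.symm _ (hf k _ (hπ.1 k x))

/-- A homogeneous element in the image of a graded map is the image of a homogeneous element. -/
lemma IsGrading.exists_mem_eq (hπ : IsGrading 𝒜 π) (hρ : IsGrading ℬ ρ) (f : M →ₗ[K] N)
    (hf : ∀ m, ∀ x ∈ 𝒜 m, f x ∈ ℬ m) {m : ℤ} {x : M} (hx : f x ∈ ℬ m) :
    ∃ y ∈ 𝒜 m, f y = f x :=
  ⟨π m x, hπ.1 m x, by rw [hπ.map_proj hρ f hf, hρ.2.1 m _ hx]⟩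

lemma IsGrading.shift (hπ : IsGrading 𝒜 π) (d : ℤ) :
    IsGrading (fun m => 𝒜 (m + d)) fun m => π (m + d) := by
  classical
  refine ⟨fun m => hπ.1 _, fun m => hπ.2.1 _, fun m k h => hπ.2.2.1 _ _ (by omega), fun x => ?_⟩
  obtain ⟨s₀, hs₀⟩ := hπ.2.2.2 x
  refine ⟨s₀.image (· - d), fun s hs => ?_⟩
  refine (Finset.sum_map s (addRightEmbedding d) fun m => π m x).symm.trans ?_
  refine hs₀ _ fun m hm => Finset.mem_map.mpr ⟨m - d, hs (Finset.mem_image_of_mem _ hm), ?_⟩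
  simp

lemma IsGrading.prod (hπ : IsGrading 𝒜 π) (hρ : IsGrading ℬ ρ) :
    IsGrading (fun m => (𝒜 m).prod (ℬ m)) fun m => (π m).prodMap (ρ m) := by
  classical
  refine ⟨fun m x => ⟨hπ.1 _ _, hρ.1 _ _⟩, fun m x hx =>
    Prod.ext (hπ.2.1 _ _ hx.1) (hρ.2.1 _ _ hx.2),
    fun m k h x hx => Prod.ext (hπ.2.2.1 _ _ h _ hx.1) (hρ.2.2.1 _ _ h _ hx.2), fun x => ?_⟩
  obtain ⟨s₀, hs₀⟩ := hπ.2.2.2 x.1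
  obtain ⟨s₁, hs₁⟩ := hρ.2.2.2 x.2
  refine ⟨s₀ ∪ s₁, fun s hs => Prod.ext ?_ ?_⟩
  · rw [Prod.fst_sum]
    exact hs₀ s (Finset.union_subset_left hs)
  · rw [Prod.snd_sum]
    exact hs₁ s (Finset.union_subset_right hs)

lemma IsGrading.pi {ι : Type*} [Finite ι] {M : ι → Type*} [∀ i, AddCommGroup (M i)]
    [∀ i, Module K (M i)] {𝒜 : ∀ i, ℤ → Submodule K (M i)} {π : ∀ i, ℤ → M i →ₗ[K] M i}
    (h : ∀ i, IsGrading (𝒜 i) (π i)) :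
    IsGrading (fun m => Submodule.pi Set.univ fun i => 𝒜 i m)
      fun m => LinearMap.pi fun i => π i m ∘ₗ LinearMap.proj i := by
  classical
  cases nonempty_fintype ι
  refine ⟨fun m x i _ => (h i).1 _ _, fun m x hx => funext fun i => (h i).2.1 _ _ (hx i trivial),
    fun m k hmk x hx => funext fun i => (h i).2.2.1 _ _ hmk _ (hx i trivial), fun x => ?_⟩
  choose s₀ hs₀ using fun i => (h i).2.2.2 (x i)
  refine ⟨Finset.univ.biUnion s₀, fun s hs => funext fun i => ?_⟩
  rw [Finset.sum_apply]
  exact hs₀ i s ((Finset.subset_biUnion_of_mem s₀ (Finset.mem_univ i)).trans hs)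

/-- A submodule that is stable under the projections inherits the grading. -/
lemma IsGrading.submodule {R : Type*} [CommRing R] [Algebra K R] [Module R M] [IsScalarTower K R M]
    (hπ : IsGrading 𝒜 π) (Q : Submodule R M) (hQ : ∀ m, ∀ x ∈ Q, π m x ∈ Q) :
    ∃ ρ, IsGrading (fun m => (𝒜 m).comap (Q.subtype.restrictScalars K)) ρ := by
  refine ⟨fun m =>
    { toFun := fun x => ⟨π m x, hQ m x x.2⟩
      map_add' := fun x y => Subtype.ext (map_add (π m) (x : M) y)
      map_smul' := fun r x => Subtype.ext (map_smul (π m) r (x : M)) },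
    fun m x => hπ.1 m x, fun m x hx => Subtype.ext (hπ.2.1 m x hx),
    fun m k h x hx => Subtype.ext (hπ.2.2.1 m k h x hx), fun x => ?_⟩
  obtain ⟨s₀, hs₀⟩ := hπ.2.2.2 (x : M)
  refine ⟨s₀, fun s hs => Subtype.ext ?_⟩
  rw [AddSubmonoidClass.coe_finsetSum]
  exact hs₀ s hs

end

section

variable {K A B C D : Type*} [Field K] [AddCommGroup A] [Module K A] [AddCommGroup B] [Module K B]
  [AddCommGroup C] [Module K C] [AddCommGroup D] [Module K D]

open Module

lemma finrank_map_add_finrank_inf_ker (g : A →ₗ[K] B) (P : Submodule K A) [Module.Finite K P] :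
    finrank K (P.map g) + finrank K (P ⊓ LinearMap.ker g : Submodule K A) = finrank K P := by
  rw [← LinearMap.finrank_range_add_finrank_ker (g.domRestrict P), LinearMap.range_domRestrict,
    LinearMap.ker_domRestrict, ← Submodule.map_comap_subtype, Submodule.finrank_map_subtype_eq]

lemma finrank_map_of_injective {f : A →ₗ[K] B} (hf : Function.Injective f) (P : Submodule K A) :
    finrank K (P.map f) = finrank K P :=
  (Submodule.equivMapOfInjective f hf P).finrank_eq.symm

/-- The identification of `P × Q`, as a subspace of `A × B`, with the product of `P` and `Q`. -/
def submoduleProdEquiv (P : Submodule K A) (Q : Submodule K B) : P.prod Q ≃ₗ[K] P × Q where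
  toFun x := (⟨x.1.1, x.2.1⟩, ⟨x.1.2, x.2.2⟩)
  invFun x := ⟨(x.1, x.2), x.1.2, x.2.2⟩
  map_add' _ _ := rfl
  map_smul' _ _ := rfl
  left_inv _ := rfl
  right_inv _ := rfl

lemma finrank_submodule_prod (P : Submodule K A) (Q : Submodule K B) [Module.Finite K P]
    [Module.Finite K Q] : finrank K (P.prod Q) = finrank K P + finrank K Q := by
  rw [← Module.finrank_prod]
  exact (submoduleProdEquiv P Q).finrank_eq

/-- The identification of `∏ Pᵢ`, as a subspace of `∏ Mᵢ`, with the product of the `Pᵢ`. -/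
def submodulePiEquiv {ι : Type*} {M : ι → Type*} [∀ i, AddCommGroup (M i)] [∀ i, Module K (M i)]
    (P : ∀ i, Submodule K (M i)) : Submodule.pi Set.univ P ≃ₗ[K] ∀ i, P i where
  toFun x i := ⟨x.1 i, x.2 i trivial⟩
  invFun x := ⟨fun i => x i, fun i _ => (x i).2⟩
  map_add' _ _ := rfl
  map_smul' _ _ := rfl
  left_inv _ := rfl
  right_inv _ := rfl

lemma finrank_of_exact {P : Submodule K A} {Q : Submodule K B} {R : Submodule K C}
    {T : Submodule K D} [Module.Finite K P] [Module.Finite K Q] [Module.Finite K R]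
    {f : A →ₗ[K] B} {g : B →ₗ[K] C} {h : C →ₗ[K] D} (hf : Function.Injective f)
    (hfg : P.map f = Q ⊓ LinearMap.ker g) (hgh : Q.map g = R ⊓ LinearMap.ker h)
    (hh : R.map h = T) : finrank K T + finrank K Q = finrank K P + finrank K R := by
  have h1 := finrank_map_of_injective hf P
  have h2 := finrank_map_add_finrank_inf_ker g Q
  have h3 := finrank_map_add_finrank_inf_ker h R
  rw [hfg] at h1
  rw [hgh] at h2
  rw [hh] at h3
  omega

end

end GradedPieces

section HilbertSeries

variable {K : Type*} [Field K] {n : ℕ}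

open Module

lemma isGrading_homogPart : IsGrading (homogPart K n) (homogProj K n) := by
  classical
  refine ⟨homogProj_mem, fun m x => homogProj_eq_self, fun m k h x => homogProj_eq_zero h,
    fun x => ⟨x.support.image fun s => ((Finsupp.degree s : ℕ) : ℤ), fun s hs => ?_⟩⟩
  ext u
  rw [MvPolynomial.coeff_sum]
  simp only [coeff_homogProj]
  rw [Finset.sum_ite_eq]
  split_ifs with hu
  · rfl
  · by_contra h0
    exact hu (hs (Finset.mem_image_of_mem _ (MvPolynomial.mem_support_iff.mpr (Ne.symm h0))))

lemma isGrading_freePart {ι : Type*} [Finite ι] (a : ι → ℤ) :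
    IsGrading (freePart K n a) fun m =>
      LinearMap.pi fun i => homogProj K n (m - a i) ∘ₗ LinearMap.proj i := by
  have := IsGrading.pi fun i => (isGrading_homogPart (K := K) (n := n)).shift (-a i)
  exact this

lemma mem_freePart_iff {ι : Type*} {a : ι → ℤ} {m : ℤ} {v : ι → PolyRing K n} :
    v ∈ freePart K n a m ↔ ∀ i, v i ∈ homogPart K n (m - a i) := by
  simp [freePart, Submodule.mem_pi]

instance finite_freePart {ι : Type*} [Finite ι] (a : ι → ℤ) (m : ℤ) :
    Module.Finite K (freePart K n a m) :=
  Module.Finite.equiv (submodulePiEquiv fun i => homogPart K n (m - a i)).symm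

lemma finrank_freePart {ι : Type*} [Fintype ι] (a : ι → ℤ) (m : ℤ) :
    finrank K (freePart K n a m) = ∑ i, finrank K (homogPart K n (m - a i)) := by
  rw [← Module.finrank_pi_fintype]
  exact (submodulePiEquiv fun i => homogPart K n (m - a i)).finrank_eq

lemma X_mul_mem_homogPart (j : Fin n) {k : ℤ} {f : PolyRing K n} (hf : f ∈ homogPart K n k) :
    MvPolynomial.X j * f ∈ homogPart K n (k + 1) := by
  rw [mem_homogPart_iff] at hf ⊢
  intro s hs
  rw [MvPolynomial.coeff_X_mul'] at hs
  split_ifs at hs with hj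
  · rw [← hf _ hs]
    have h : s = s - Finsupp.single j 1 + Finsupp.single j 1 :=
      (tsub_add_cancel_of_le (Finsupp.single_le_iff.mpr
        (Nat.one_le_iff_ne_zero.mpr (Finsupp.mem_support_iff.mp hj)))).symm
    conv_lhs => rw [h]
    simp
  · exact absurd rfl hs

/-- The Koszul differential is homogeneous of degree `0`, if `e_L` has degree `#L`. -/
lemma koszulD_mem_freePart {m : ℤ} {v : Koszul K n}
    (hv : v ∈ freePart K n (fun L : Finset (Fin n) => (L.card : ℤ)) m) :
    koszulD K n v ∈ freePart K n (fun L : Finset (Fin n) => (L.card : ℤ)) m := by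
  rw [mem_freePart_iff] at hv ⊢
  intro J
  rw [koszulD_apply]
  refine Submodule.sum_mem _ fun j hj => ?_
  have hc : (insert j J).card = J.card + 1 := Finset.card_insert_of_notMem (by simpa using hj)
  have h1 := X_mul_mem_homogPart j (hv (insert j J))
  rw [hc, show m - ((J.card + 1 : ℕ) : ℤ) + 1 = m - J.card by push_cast; ring] at h1
  have h2 : ((-1 : PolyRing K n) ^ (J.filter (· < j)).card * MvPolynomial.X j) * v (insert j J) =
      ((-1 : K) ^ (J.filter (· < j)).card) • (MvPolynomial.X j * v (insert j J)) := by
    rw [MvPolynomial.smul_eq_C_mul, map_pow, map_neg, map_one, mul_assoc]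
  rw [h2]
  exact Submodule.smul_mem _ _ h1

/-- The Koszul complex is graded, with `e_L` in degree `#L`. -/
lemma exists_isGrading_koszul : ∃ π, IsGrading
    (freePart K n fun L : Finset (Fin n) => (L.card : ℤ)) π ∧
      (∀ i m, ∀ v ∈ koszulPart K n i, π m v ∈ koszulPart K n i) ∧
      ∀ i m, ∀ v ∈ syzygy K n i, π m v ∈ syzygy K n i := by
  refine ⟨_, isGrading_freePart _, ?_, ?_⟩
  · intro i m v hv L hL
    have := hv L hL
    simp [this]
  · rintro i m _ ⟨v, hv, rfl⟩
    have := (isGrading_freePart (K := K) (n := n) _).map_proj (isGrading_freePart _)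
      ((koszulD K n).restrictScalars K) (fun m x => koszulD_mem_freePart) m v
    refine ⟨_, ?_, this⟩
    intro L hL
    have := hv L hL
    simp [this]

/-- The part of degree `m` of `Kᵢ`. -/
def koszulDegPart (K : Type*) [Field K] (n i : ℕ) (m : ℤ) : Submodule K (Koszul K n) :=
  freePart K n (fun L : Finset (Fin n) => (L.card : ℤ)) m ⊓ (koszulPart K n i).restrictScalars K

/-- The part of degree `m` of `Eᵢ`, as a subspace of the Koszul complex. -/
def syzygyDegPart (K : Type*) [Field K] (n i : ℕ) (m : ℤ) : Submodule K (Koszul K n) :=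
  freePart K n (fun L : Finset (Fin n) => (L.card : ℤ)) m ⊓ (syzygy K n i).restrictScalars K

instance finite_koszulDegPart (i : ℕ) (m : ℤ) : Module.Finite K (koszulDegPart K n i m) :=
  Submodule.finiteDimensional_of_le (inf_le_left : koszulDegPart K n i m ≤ _)

instance finite_syzygyDegPart (i : ℕ) (m : ℤ) : Module.Finite K (syzygyDegPart K n i m) :=
  Submodule.finiteDimensional_of_le (inf_le_left : syzygyDegPart K n i m ≤ _)

lemma map_syzygyPart (i : ℕ) (m : ℤ) :
    (syzygyPart K n i m).map ((syzygy K n i).subtype.restrictScalars K) = syzygyDegPart K n i m := by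
  ext v
  constructor
  · rintro ⟨x, hx, rfl⟩
    exact ⟨hx, x.2⟩
  · exact fun hv => ⟨⟨v, hv.2⟩, hv.1, rfl⟩

lemma finrank_syzygyPart (i : ℕ) (m : ℤ) :
    finrank K (syzygyPart K n i m) = finrank K (syzygyDegPart K n i m) := by
  rw [← map_syzygyPart, finrank_map_of_injective Subtype.val_injective]

instance finite_syzygyPart (i : ℕ) (m : ℤ) : Module.Finite K (syzygyPart K n i m) := by
  have h := finite_syzygyDegPart (K := K) (n := n) i m
  rw [← map_syzygyPart] at h
  exact Module.Finite.equiv (Submodule.equivMapOfInjective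
    ((syzygy K n i).subtype.restrictScalars K) Subtype.val_injective _).symm

lemma finrank_koszulDegPart (i : ℕ) (m : ℤ) :
    finrank K (koszulDegPart K n i m) = n.choose i * finrank K (homogPart K n (m - i)) := by
  classical
  let e : koszulDegPart K n i m ≃ₗ[K] ({L : Finset (Fin n) // L.card = i} →
      homogPart K n (m - i)) :=
    { toFun := fun v L => ⟨v.1 L.1, by simpa [L.2] using mem_freePart_iff.mp v.2.1 L.1⟩
      invFun := fun w => ⟨fun L => if hL : L.card = i then w ⟨L, hL⟩ else 0, by
        constructor
        · refine mem_freePart_iff.mpr fun L => ?_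
          by_cases hL : L.card = i
          · subst hL
            simp
          · simp [hL]
        · intro L hL
          simp [hL]⟩
      map_add' := fun _ _ => rfl
      map_smul' := fun _ _ => rfl
      left_inv := fun v => by
        refine Subtype.ext (funext fun L => ?_)
        by_cases hL : L.card = i
        · simp [hL]
        · simpa [hL] using (v.2.2 L hL).symm
      right_inv := fun w => by
        refine funext fun L => Subtype.ext ?_
        simp [L.2] }
  rw [e.finrank_eq, Module.finrank_pi_fintype, Finset.sum_const, Finset.card_univ, smul_eq_mul,
    Fintype.card_finset_len, Fintype.card_fin]

/-- The exact sequence `0 → E_{i+1} → Kᵢ → Eᵢ → 0` in degree `m`. -/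
lemma finrank_syzygyDegPart_add {i : ℕ} (hi : i ≠ 0) (m : ℤ) :
    finrank K (syzygyDegPart K n i m) + finrank K (syzygyDegPart K n (i + 1) m) =
      n.choose i * finrank K (homogPart K n (m - i)) := by
  obtain ⟨π, hπ, hπK, -⟩ := exists_isGrading_koszul (K := K) (n := n)
  rw [← finrank_koszulDegPart,
    ← finrank_map_add_finrank_inf_ker ((koszulD K n).restrictScalars K) (koszulDegPart K n i m)]
  have h1 : syzygyDegPart K n i m =
      (koszulDegPart K n i m).map ((koszulD K n).restrictScalars K) := by
    ext v
    constructor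
    · rintro ⟨hv, w, hw, rfl⟩
      refine ⟨π m w, ⟨hπ.1 m w, hπK i m w hw⟩, ?_⟩
      rw [hπ.map_proj hπ _ fun m x => koszulD_mem_freePart]
      exact hπ.2.1 m _ hv
    · rintro ⟨w, hw, rfl⟩
      exact ⟨koszulD_mem_freePart hw.1, w, hw.2, rfl⟩
  have h2 : syzygyDegPart K n (i + 1) m =
      koszulDegPart K n i m ⊓ LinearMap.ker ((koszulD K n).restrictScalars K) := by
    ext v
    constructor
    · rintro ⟨hv, hv'⟩
      obtain ⟨h1, h2⟩ := (mem_syzygy_succ_iff hi).mp hv'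
      exact ⟨⟨hv, h1⟩, h2⟩
    · rintro ⟨⟨hv, h1⟩, h2⟩
      exact ⟨hv, (mem_syzygy_succ_iff hi).mpr ⟨h1, h2⟩⟩
  rw [h1, h2]

/-- The dimension formula coming from a long Bourbaki sequence in degree `m`. -/
lemma IsLongBourbakiSequence.finrank_eq {t p q : ℕ} {d c : ℤ}
    {a : Fin p → ℤ} {b : Fin q → ℤ} {I : Ideal (PolyRing K n)}
    {f : (Fin p → PolyRing K n) →ₗ[PolyRing K n] (Fin q → PolyRing K n)}
    {g : (Fin q → PolyRing K n) →ₗ[PolyRing K n] syzygy K n (t + 1) × syzygy K n (n - 1)}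
    {φ : (syzygy K n (t + 1) × syzygy K n (n - 1)) →ₗ[PolyRing K n] I}
    (h : IsLongBourbakiSequence d c a b I f g φ) (hI : IsGradedIdeal I) (m : ℤ) :
    finrank K (homogPart K n (m + c) ⊓ I.restrictScalars K : Submodule K (PolyRing K n)) +
      ∑ i, finrank K (homogPart K n (m - b i)) =
    ∑ i, finrank K (homogPart K n (m - a i)) +
      (finrank K (syzygyDegPart K n (t + 1) m) +
        finrank K (syzygyDegPart K n (n - 1) (m + d))) := by
  obtain ⟨π, hπ, -, hπS⟩ := exists_isGrading_koszul (K := K) (n := n)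
  obtain ⟨ρ₁, hρ₁⟩ := hπ.submodule (syzygy K n (t + 1)) fun m => hπS _ m
  obtain ⟨ρ₂, hρ₂⟩ := hπ.submodule (syzygy K n (n - 1)) fun m => hπS _ m
  obtain ⟨σ, hσ⟩ := isGrading_homogPart.submodule I fun m x hx => hI.homogProj_mem hx m
  have hA := isGrading_freePart (K := K) (n := n) a
  have hB := isGrading_freePart (K := K) (n := n) b
  have hC : IsGrading (sumPart K n (t + 1) (n - 1) d) _ := hρ₁.prod (hρ₂.shift d)
  have hD : IsGrading (idealPart K n I c) _ := hσ.shift c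
  have hDm : (idealPart K n I c m).map (I.subtype.restrictScalars K) =
      homogPart K n (m + c) ⊓ I.restrictScalars K := by
    ext v
    constructor
    · rintro ⟨x, hx, rfl⟩
      exact ⟨hx, x.2⟩
    · exact fun hv => ⟨⟨v, hv.2⟩, hv.1, rfl⟩
  have hfin : Module.Finite K
      ((syzygyPart K n (t + 1) m).prod (syzygyPart K n (n - 1) (m + d))) :=
    Module.Finite.equiv (submoduleProdEquiv _ _).symm
  rw [← hDm, finrank_map_of_injective (f := I.subtype.restrictScalars K) Subtype.val_injective,
    ← finrank_freePart a, ← finrank_freePart b, ← finrank_syzygyPart, ← finrank_syzygyPart,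
    ← finrank_submodule_prod (syzygyPart K n (t + 1) m)]

  refine finrank_of_exact (f := f.restrictScalars K) (g := g.restrictScalars K)
    (h := φ.restrictScalars K) h.injective_f ?_ ?_ ?_
  · ext y
    constructor
    · rintro ⟨x, hx, rfl⟩
      exact ⟨h.graded_f m x hx, h.exact_f_g.apply_apply_eq_zero x⟩
    · rintro ⟨hy, hy0⟩
      obtain ⟨x, rfl⟩ := (h.exact_f_g y).mp hy0
      exact hA.exists_mem_eq hB (f.restrictScalars K) h.graded_f hy
  · ext y
    constructor
    · rintro ⟨x, hx, rfl⟩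
      exact ⟨h.graded_g m x hx, h.exact_g_φ.apply_apply_eq_zero x⟩
    · rintro ⟨hy, hy0⟩
      obtain ⟨x, rfl⟩ := (h.exact_g_φ y).mp hy0
      exact hB.exists_mem_eq hC (g.restrictScalars K) h.graded_g hy
  · ext y
    constructor
    · rintro ⟨x, hx, rfl⟩
      exact h.graded_φ m x hx
    · intro hy
      obtain ⟨x, rfl⟩ := h.surjective_φ y
      exact hC.exists_mem_eq hD (φ.restrictScalars K) h.graded_φ hy

end HilbertSeries

section HilbertPolynomial

/-! ### Hilbert polynomials, moments and height -/

open Polynomial Filter Topology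

lemma coeff_taylor_sub {N k : ℕ} {P : ℝ[X]} (hP : P.natDegree = N) (hk : k ≤ N) (r : ℝ) :
    (taylor r P).coeff (N - k) = ∑ j ∈ Finset.range (k + 1),
      ((N - k + j).choose (N - k) * P.coeff (N - k + j)) * r ^ j := by
  have h : (hasseDeriv (N - k) P).natDegree < k + 1 := by
    have := natDegree_hasseDeriv_le P (N - k)
    omega
  rw [taylor_coeff, eval_eq_sum_range' h]
  refine Finset.sum_congr rfl fun j _ => ?_
  rw [hasseDeriv_coeff, add_comm j]

/-- A linear combination of translates of a polynomial of degree `N` has degree less than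
`N + 1 - s` if and only if the moments of order less than `s` of the weights and translations
vanish: the passage from these moments to the coefficients of the `s` highest powers is
triangular. -/
lemma degree_sum_taylor_lt_iff {ι : Type*} [Fintype ι] (w r : ι → ℝ) {N s : ℕ} {P : ℝ[X]}
    (hP : P.natDegree = N) (hP0 : P ≠ 0) (hs : s ≤ N + 1) :
    (∑ i, w i • taylor (r i) P).degree < (N + 1 - s : ℕ) ↔ ∀ j < s, ∑ i, w i * r i ^ j = 0 := by
  have hcoeff (k : ℕ) (hk : k ≤ N) : (∑ i, w i • taylor (r i) P).coeff (N - k) =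
      ∑ j ∈ Finset.range (k + 1), ((N - k + j).choose (N - k) * P.coeff (N - k + j)) *
        ∑ i, w i * r i ^ j := by
    rw [finsetSum_coeff]
    simp only [coeff_smul, coeff_taylor_sub hP hk, smul_eq_mul, Finset.mul_sum]
    rw [Finset.sum_comm]
    refine Finset.sum_congr rfl fun i _ => Finset.sum_congr rfl fun j _ => ?_
    ring
  have hdeg : (∑ i, w i • taylor (r i) P).natDegree ≤ N := by
    refine natDegree_sum_le_of_forall_le _ _ fun i _ => ?_
    exact (natDegree_smul_le _ _).trans (by rw [natDegree_taylor, hP])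
  rw [degree_lt_iff_coeff_zero]
  constructor
  · intro h j
    induction j using Nat.strong_induction_on with
    | _ j ih =>
      intro hj
      have h1 := hcoeff j (by omega)
      rw [h _ (by omega), Finset.sum_range_succ, Finset.sum_eq_zero, zero_add] at h1
      · refine (mul_eq_zero.mp h1.symm).resolve_left ?_
        rw [Nat.sub_add_cancel (by omega)]
        refine mul_ne_zero (Nat.cast_ne_zero.mpr (Nat.choose_pos (Nat.sub_le _ _)).ne') ?_
        rw [← hP]
        exact leadingCoeff_ne_zero.mpr hP0
      · intro l hl
        rw [ih l (Finset.mem_range.mp hl) (by have := Finset.mem_range.mp hl; omega), mul_zero]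
  · intro h m hm
    by_cases hmN : N < m
    · exact coeff_eq_zero_of_natDegree_lt (hdeg.trans_lt hmN)
    · have h1 := hcoeff (N - m) (by omega)
      rw [show N - (N - m) = m by omega] at h1
      rw [h1]
      refine Finset.sum_eq_zero fun j hj => ?_
      rw [h j (by have := Finset.mem_range.mp hj; omega), mul_zero]

variable {K : Type*} [Field K] {n : ℕ}

open Module

/-- The height of a graded ideal is at least `h` if and only if the Hilbert polynomial of `S/I` has
degree less than `n - h`. -/
lemma le_height_iff_degree_lt {I : Ideal (PolyRing K n)} (hI : IsGradedIdeal I) {h : ℕ}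
    (hh : 1 ≤ h) (hn : h + 1 ≤ n) {G : ℝ[X]}
    (hG : ∀ᶠ m : ℕ in atTop, (finrank K
      (homogPart K n m ⊓ I.restrictScalars K : Submodule K (PolyRing K n)) : ℝ) + G.eval (m : ℝ) =
        finrank K (homogPart K n m)) :
    (h : ℕ∞) ≤ I.height ↔ G.degree < (n - h : ℕ) := by
  constructor
  · intro hIh
    obtain ⟨B, hB⟩ := exists_finrank_homogPart_le hI (r := n - h) (by omega) (by omega)
      fun T hT => not_indepVars_of_lt_height (by
        calc ((n : ℕ) : ℕ∞) < ((h + T.card : ℕ) : ℕ∞) := by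
              rw [hT]; exact_mod_cast (by omega)
          _ = (h : ℕ∞) + T.card := by push_cast; rfl
          _ ≤ _ := by gcongr)
    by_contra hdeg
    let Q : ℝ[X] := (X + 1) ^ (n - h - 1)
    have hQm : Q.Monic := (monic_X_add_C (1 : ℝ)).pow _
    have hQd : Q.degree < G.degree := by
      have : Q.degree = (n - h - 1 : ℕ) := by
        simp only [Q]
        rw [degree_pow, show (X + 1 : ℝ[X]) = X + C 1 by simp, degree_X_add_C]
        simp
      rw [this]
      refine lt_of_lt_of_le ?_ (not_lt.mp hdeg)
      exact_mod_cast (by omega)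
    have hlim := (abs_div_tendsto_atTop_atTop_of_degree_gt G Q hQd hQm.ne_zero).comp
      tendsto_natCast_atTop_atTop
    obtain ⟨m, hm1, hm2⟩ := (hG.and (hlim.eventually_gt_atTop (B : ℝ))).exists
    have hQe : Q.eval (m : ℝ) = ((m : ℝ) + 1) ^ (n - h - 1) := by simp [Q]
    have hQpos : 0 < Q.eval (m : ℝ) := by rw [hQe]; positivity
    have h1 : (finrank K (homogPart K n m) : ℝ) ≤ finrank K
      (homogPart K n m ⊓ I.restrictScalars K : Submodule K (PolyRing K n)) +
        B * (m + 1) ^ (n - h - 1) := by exact_mod_cast hB m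
    have h2 : (finrank K (homogPart K n m ⊓ I.restrictScalars K : Submodule K (PolyRing K n)) : ℝ)
        ≤ finrank K (homogPart K n m) := by
      exact_mod_cast Submodule.finrank_mono inf_le_left
    have h3 : G.eval (m : ℝ) ≤ B * Q.eval (m : ℝ) := by rw [hQe]; linarith
    have h4 : 0 ≤ G.eval (m : ℝ) := by linarith
    simp only [Function.comp_apply] at hm2
    rw [abs_of_nonneg (div_nonneg h4 hQpos.le), lt_div_iff₀ hQpos] at hm2
    linarith
  · intro hdeg
    by_contra hIh
    obtain ⟨T, hT, hTc⟩ := exists_indepVars_of_height_le (I := I) (h := h - 1) (by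
      rw [not_le] at hIh
      have : ((h : ℕ) : ℕ∞) = ((h - 1 : ℕ) : ℕ∞) + 1 := by
        exact_mod_cast (Nat.sub_add_cancel hh).symm
      rw [this] at hIh
      exact Order.lt_add_one_iff_of_not_isMax (by simp) |>.mp hIh)
    -- along `m = n * k` the lower bound is a polynomial in `k`
    let F : ℝ[X] := G.comp (C (n : ℝ) * X)
    have hFdeg : F.degree < ((X + 1 : ℝ[X]) ^ (n - h)).degree := by
      rw [degree_pow, show (X + 1 : ℝ[X]) = X + C 1 by simp, degree_X_add_C]
      by_cases hF : F = 0
      · rw [hF, degree_zero]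
        exact bot_lt_iff_ne_bot.mpr (by simp)
      have hG0 : G ≠ 0 := by
        rintro rfl
        exact hF (by simp [F])
      have h1 : F.natDegree ≤ G.natDegree := by
        refine natDegree_comp_le.trans ?_
        have : (C (n : ℝ) * X).natDegree ≤ 1 := (natDegree_C_mul_le _ _).trans natDegree_X_le
        nlinarith
      rw [degree_eq_natDegree hG0] at hdeg
      rw [degree_eq_natDegree hF]
      have h2 : G.natDegree < n - h := by exact_mod_cast hdeg
      simp
      omega
    have hlim := (div_tendsto_atTop_zero_of_degree_lt _ _ hFdeg).comp
      (tendsto_natCast_atTop_atTop (R := ℝ))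
    have hnk : Tendsto (fun k : ℕ => n * k) atTop atTop :=
      tendsto_id.const_mul_atTop' (by omega)
    obtain ⟨k, hk1, hk2⟩ := ((hnk.eventually hG).and
      (hlim.eventually (gt_mem_nhds one_pos))).exists
    have hpow := pow_le_finrank_homogPart_sub hT (by omega) (le_refl (n * k))
    have hpow' : (k + 1) ^ (n - h) ≤ (k + 1) ^ (T.card - 1) :=
      Nat.pow_le_pow_right (by omega) (by omega)
    have h1 : ((k : ℝ) + 1) ^ (n - h) + finrank K
        (homogPart K n (n * k : ℕ) ⊓ I.restrictScalars K : Submodule K (PolyRing K n)) ≤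
        finrank K (homogPart K n (n * k : ℕ)) := by
      exact_mod_cast (Nat.add_le_add_right hpow' _).trans hpow
    have hF : F.eval (k : ℝ) = G.eval ((n * k : ℕ) : ℝ) := by simp [F]
    have hpos : 0 < ((k : ℝ) + 1) ^ (n - h) := by positivity
    simp only [Function.comp_apply, eval_pow, eval_add, eval_X, eval_one] at hk2
    rw [div_lt_one hpos, hF] at hk2
    linarith

/-- If the Hilbert function of `S/I` is, up to a shift, a combination of translates of the Hilbert
function of `S`, then the height of `I` is at least `h` if and only if the moments of order less
than `h` vanish. -/
lemma le_height_iff_moments {I : Ideal (PolyRing K n)} (hI : IsGradedIdeal I) {h : ℕ}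
    (hh : 1 ≤ h) (hn : h + 1 ≤ n) {ι : Type*} [Fintype ι] (w r : ι → ℤ) (c : ℤ)
    (hw : ∀ m : ℤ, (finrank K
      (homogPart K n (m + c) ⊓ I.restrictScalars K : Submodule K (PolyRing K n)) : ℤ) +
        ∑ i, w i * finrank K (homogPart K n (m + r i)) = finrank K (homogPart K n (m + c))) :
    (h : ℕ∞) ≤ I.height ↔ ∀ j < h, ∑ i, w i * r i ^ j = 0 := by
  let P : ℝ[X] := preHilbertPoly ℝ (n - 1) 0
  have hPd : P.natDegree = n - 1 := natDegree_preHilbertPoly ..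
  have hP0 : P ≠ 0 := by
    intro h0
    rw [h0, natDegree_zero] at hPd
    omega
  have hPe (m : ℕ) : P.eval (m : ℝ) = finrank K (homogPart K n m) := by
    rw [finrank_homogPart (by omega), preHilbertPoly_eq_choose_sub_add _ _ (Nat.zero_le _)]
    simp
  let H : ℝ[X] := ∑ i, (w i : ℝ) • taylor (r i : ℝ) P
  rw [le_height_iff_degree_lt hI hh hn (G := taylor (-c : ℝ) H), degree_taylor,
    show n - h = n - 1 + 1 - h by omega, degree_sum_taylor_lt_iff _ _ hPd hP0 (by omega)]
  · exact forall₂_congr fun j _ => by norm_cast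
  · have hlarge : ∀ᶠ m : ℕ in atTop, ∀ i, c - r i ≤ m :=
      eventually_all.mpr fun i => (eventually_ge_atTop (c - r i).toNat).mono fun m hm =>
        (Int.self_le_toNat _).trans (by exact_mod_cast hm)
    filter_upwards [hlarge] with m hm
    have h1 := hw (m - c)
    rw [sub_add_cancel] at h1
    rw [taylor_eval]
    have h2 : H.eval ((m : ℝ) + -c) =
        ((∑ i, w i * finrank K (homogPart K n (m - c + r i)) : ℤ) : ℝ) := by
      rw [eval_finsetSum, Int.cast_sum]
      refine Finset.sum_congr rfl fun i _ => ?_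
      obtain ⟨k, hk⟩ := Int.eq_ofNat_of_zero_le (show (0 : ℤ) ≤ m - c + r i by linarith [hm i])
      have hk' : (m : ℝ) + -c + r i = k := by
        have : ((m - c + r i : ℤ) : ℝ) = ((k : ℤ) : ℝ) := by rw [hk]
        push_cast at this
        linarith
      rw [eval_smul, taylor_eval, hk', hk, hPe]
      simp
    rw [h2]
    exact_mod_cast h1

end HilbertPolynomial

section AlternatingSums

/-! ### Alternating binomial sums -/

lemma binom_natCast (m k : ℕ) : binom m k = m.choose k := by
  simp [binom]

/-- Pascal's rule, for all integers `k`. -/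
lemma binom_succ (m : ℕ) (k : ℤ) : binom (m + 1) k = binom m (k - 1) + binom m k := by
  rcases lt_trichotomy k 0 with hk | rfl | hk
  · simp [binom, hk.not_ge, show ¬ 1 ≤ k by omega]
  · simp [binom]
  · obtain ⟨l, rfl⟩ : ∃ l : ℕ, k = l + 1 := ⟨(k - 1).toNat, by omega⟩
    rw [add_sub_cancel_right, show (l : ℤ) + 1 = ((l + 1 : ℕ) : ℤ) by push_cast; rfl]
    simp only [binom_natCast]
    exact_mod_cast Nat.choose_succ_succ m l

/-- The alternating sum `∑_{j ≥ i} (-1)^{j-i} (n choose j) F(j)`. -/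
def altBinomSum (n i : ℕ) (F : ℕ → ℤ) : ℤ :=
  ∑ j : Fin (n + 1), (if i ≤ j then (-1) ^ ((j : ℕ) + i) * (n.choose j : ℤ) else 0) * F j

lemma altBinomSum_succ (n : ℕ) (F : ℕ → ℤ) : altBinomSum n (n + 1) F = 0 := by
  refine Finset.sum_eq_zero fun j _ => ?_
  rw [if_neg (by omega), zero_mul]

lemma altBinomSum_add (n : ℕ) {i : ℕ} (hi : i ≤ n) (F : ℕ → ℤ) :
    altBinomSum n i F + altBinomSum n (i + 1) F = n.choose i * F i := by
  rw [altBinomSum, altBinomSum, ← Finset.sum_add_distrib,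
    Finset.sum_eq_single_of_mem (⟨i, by omega⟩ : Fin (n + 1)) (Finset.mem_univ _)]
  · have h : (-1 : ℤ) ^ (i + i) = 1 := Even.neg_one_pow ⟨i, rfl⟩
    simp [h]
  · intro j _ hj
    have hj' : (j : ℕ) ≠ i := fun h => hj (Fin.ext h)
    by_cases h : i ≤ j
    · rw [if_pos h, if_pos (by omega), ← add_assoc, pow_succ]
      ring
    · rw [if_neg h, if_neg (by omega)]
      simp

lemma eq_altBinomSum {n : ℕ} {F u : ℕ → ℤ} (h0 : u (n + 1) = 0)
    (h : ∀ i, 1 ≤ i → i ≤ n → u i + u (i + 1) = n.choose i * F i) {i : ℕ} (hi : 1 ≤ i)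
    (hin : i ≤ n) : u i = altBinomSum n i F := by
  have key : ∀ k, k ≤ n → u (n + 1 - k) = altBinomSum n (n + 1 - k) F := by
    intro k
    induction k with
    | zero => exact fun _ => h0.trans (altBinomSum_succ n F).symm
    | succ k ih =>
      intro hk
      have h1 := h (n - k) (by omega) (by omega)
      have h2 := altBinomSum_add n (show n - k ≤ n by omega) F
      rw [show n - k + 1 = n + 1 - k by omega] at h1 h2
      rw [show n + 1 - (k + 1) = n - k by omega]
      linarith [ih (by omega)]
  have := key (n + 1 - i) (by omega)
  rwa [show n + 1 - (n + 1 - i) = i by omega] at this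

lemma altBinomSum_sub_one {n : ℕ} (hn : 1 ≤ n) (F : ℕ → ℤ) :
    altBinomSum n (n - 1) F = n * F (n - 1) - F n := by
  have h1 := altBinomSum_add n (le_refl n) F
  have h2 := altBinomSum_add n (Nat.sub_le n 1) F
  rw [altBinomSum_succ, Nat.choose_self] at h1
  rw [Nat.sub_add_cancel hn, Nat.choose_symm hn, Nat.choose_one_right] at h2
  push_cast at h1
  linarith

lemma binom_eq_zero {m : ℕ} {k : ℤ} (h : m < k) : binom m k = 0 := by
  lift k to ℕ using by omega
  rw [binom_natCast, Nat.choose_eq_zero_of_lt (by omega), Nat.cast_zero]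

lemma altBinomSum_one {n t : ℕ} (ht : t + 1 ≤ n) :
    altBinomSum n (t + 1) (fun _ => 1) = binom (n - 1) t := by
  obtain ⟨n, rfl⟩ : ∃ k, n = k + 1 := ⟨n - 1, by omega⟩
  rw [← eq_altBinomSum (u := fun i => binom n ((i : ℤ) - 1)) _ _ (by omega) ht]
  · simp
  · exact binom_eq_zero (by push_cast; omega)
  · intro i _ _
    have := binom_succ n i
    rw [← binom_natCast]
    push_cast
    rw [add_sub_cancel_right]
    linarith

lemma altBinomSum_id {n t : ℕ} (hn : 2 ≤ n) (ht : t + 1 ≤ n) :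
    altBinomSum n (t + 1) (fun j => j) = binom (n - 2) ((t : ℤ) - 1) + binom (n - 1) t * t := by
  obtain ⟨n, rfl⟩ : ∃ k, n = k + 2 := ⟨n - 2, by omega⟩
  rw [← eq_altBinomSum (u := fun i => binom n ((i : ℤ) - 1 - 1) +
    binom (n + 1) ((i : ℤ) - 1) * (i - 1)) _ _ (by omega) ht]
  · simp
  · push_cast
    rw [binom_eq_zero (by omega), binom_eq_zero (by push_cast; omega)]
    simp
  · intro i _ _
    have h1 := binom_succ n ((i : ℤ) - 1)
    have h2 := binom_succ (n + 1) i
    rw [← binom_natCast]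
    push_cast
    rw [add_sub_cancel_right]
    linear_combination (-(i : ℤ)) * h2 - h1

lemma altBinomSum_sq {n t : ℕ} (hn : 3 ≤ n) (ht : t + 1 ≤ n) :
    altBinomSum n (t + 1) (fun j => (j : ℤ) ^ 2) =
      binom (n - 1) t * ((t : ℤ) + 1) ^ 2 - binom (n - 2) t * (2 * t + 1) -
        2 * binom (n - 3) ((t : ℤ) - 1) := by
  obtain ⟨n, rfl⟩ : ∃ k, n = k + 3 := ⟨n - 3, by omega⟩
  rw [← eq_altBinomSum (u := fun i => binom (n + 2) ((i : ℤ) - 1) * (i : ℤ) ^ 2 -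
    binom (n + 1) ((i : ℤ) - 1) * (2 * i - 1) - 2 * binom n ((i : ℤ) - 1 - 1)) _ _ (by omega) ht]
  · push_cast
    rw [add_sub_cancel_right]
    ring
  · push_cast
    rw [binom_eq_zero (by push_cast; omega), binom_eq_zero (by push_cast; omega),
      binom_eq_zero (by omega)]
    simp
  · intro i _ _
    have h1 := binom_succ n ((i : ℤ) - 1)
    have h2 := binom_succ (n + 1) i
    have h3 := binom_succ (n + 2) i
    rw [← binom_natCast]
    push_cast
    rw [add_sub_cancel_right]
    linear_combination (-(i : ℤ) ^ 2) * h3 + (2 * (i : ℤ) + 1) * h2 + 2 * h1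

end AlternatingSums

section Moments

/-! ### The numerical conditions -/

open Module

variable {K : Type*} [Field K] {n : ℕ}

lemma finrank_syzygyDegPart_eq {i : ℕ} (hi : 1 ≤ i) (hin : i ≤ n) (m : ℤ) :
    (finrank K (syzygyDegPart K n i m) : ℤ) =
      altBinomSum n i fun j => finrank K (homogPart K n (m - j)) := by
  refine eq_altBinomSum (u := fun i => (finrank K (syzygyDegPart K n i m) : ℤ)) ?_ ?_ hi hin
  · have : syzygyDegPart K n (n + 1) m = ⊥ := by
      rw [syzygyDegPart, syzygy_eq_bot (Nat.lt_succ_self n), Submodule.restrictScalars_bot,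
        inf_bot_eq]
    simp [this]
  · intro i hi _
    exact_mod_cast finrank_syzygyDegPart_add (by omega) m

/-- For a long Bourbaki sequence the codimension of `I` is at least `3` if and only if the moments
of order `0`, `1`, `2` of the twists in the sequence vanish. -/
lemma IsLongBourbakiSequence.three_le_height_iff {t p q : ℕ} {d c : ℤ}
    {a : Fin p → ℤ} {b : Fin q → ℤ} {I : Ideal (PolyRing K n)}
    {f : (Fin p → PolyRing K n) →ₗ[PolyRing K n] (Fin q → PolyRing K n)}
    {g : (Fin q → PolyRing K n) →ₗ[PolyRing K n] syzygy K n (t + 1) × syzygy K n (n - 1)}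
    {φ : (syzygy K n (t + 1) × syzygy K n (n - 1)) →ₗ[PolyRing K n] I}
    (h : IsLongBourbakiSequence d c a b I f g φ) (hI : IsGradedIdeal I) (hn : 4 ≤ n)
    (ht : t + 1 ≤ n) :
    3 ≤ I.height ↔ ∀ k < 3, c ^ k + ∑ i, (-b i) ^ k - ∑ i, (-a i) ^ k -
      altBinomSum n (t + 1) (fun j => (-(j : ℤ)) ^ k) -
        altBinomSum n (n - 1) (fun j => (d - j) ^ k) = 0 := by
  let α (i : ℕ) (j : Fin (n + 1)) : ℤ :=
    if i ≤ j then (-1) ^ ((j : ℕ) + i) * (n.choose j : ℤ) else 0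
  let w : Unit ⊕ Fin q ⊕ Fin p ⊕ Fin (n + 1) ⊕ Fin (n + 1) → ℤ :=
    Sum.elim 1 (Sum.elim 1 (Sum.elim (-1) (Sum.elim (-α (t + 1)) (-α (n - 1)))))
  let r : Unit ⊕ Fin q ⊕ Fin p ⊕ Fin (n + 1) ⊕ Fin (n + 1) → ℤ :=
    Sum.elim (fun _ => c) (Sum.elim (-b) (Sum.elim (-a)
      (Sum.elim (fun j => -(j : ℤ)) (fun j => d - (j : ℤ)))))
  have hsum (F : ℤ → ℤ) : ∑ i, w i * F (r i) = F c + ∑ i, F (-b i) - ∑ i, F (-a i) -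
      altBinomSum n (t + 1) (fun j => F (-(j : ℤ))) -
        altBinomSum n (n - 1) (fun j => F (d - j)) := by
    simp only [w, r, α, altBinomSum, Fintype.sum_sum_type, Sum.elim_inl, Sum.elim_inr, Pi.one_apply,
      Pi.neg_apply, one_mul, neg_mul, Finset.sum_neg_distrib, Finset.univ_unique,
      Finset.sum_singleton]
    ring
  have key := le_height_iff_moments hI (h := 3) (by omega) hn w r c fun m => by
    let D (z : ℤ) : ℤ := finrank K (homogPart K n z)
    have h1 := h.finrank_eq hI m
    have h2 : _ = altBinomSum n (t + 1) fun j => D (m - j) :=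
      finrank_syzygyDegPart_eq (show 1 ≤ t + 1 by omega) ht m
    have h3 : _ = altBinomSum n (n - 1) fun j => D (m + d - j) :=
      finrank_syzygyDegPart_eq (show 1 ≤ n - 1 by omega) (Nat.sub_le n 1) (m + d)
    zify at h1
    rw [h2, h3] at h1
    have h4 := hsum fun z => D (m + z)
    simp only [← add_sub_assoc, ← sub_eq_add_neg] at h4
    linarith
  exact key.trans (forall₂_congr fun k _ => by rw [hsum fun z => z ^ k])

end Moments

end LongBourbaki

end

theorem proposition3p4 {K : Type*} [Field K] {n t p q : ℕ} (hn : 4 ≤ n) (ht : t + 4 ≤ n)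
    (d c : ℤ) (a : Fin p → ℤ) (b : Fin q → ℤ)
    (I : Ideal (LongBourbaki.PolyRing K n))
    (hIgr : LongBourbaki.IsGradedIdeal I)
    (hIm : I ≠ Ideal.span (Set.range (MvPolynomial.X : Fin n → MvPolynomial (Fin n) K)))
    (f : (Fin p → LongBourbaki.PolyRing K n) →ₗ[LongBourbaki.PolyRing K n]
      (Fin q → LongBourbaki.PolyRing K n))
    (g : (Fin q → LongBourbaki.PolyRing K n) →ₗ[LongBourbaki.PolyRing K n]
      LongBourbaki.syzygy K n (t + 1) × LongBourbaki.syzygy K n (n - 1))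
    (φ : (LongBourbaki.syzygy K n (t + 1) × LongBourbaki.syzygy K n (n - 1))
      →ₗ[LongBourbaki.PolyRing K n] I)
    (hseq : LongBourbaki.IsLongBourbakiSequence d c a b I f g φ) :
    I.height ≤ 3 ∧
    (I.height = 3 ↔
      (q : ℤ) = p + LongBourbaki.binom (n - 1) t + n - 2 ∧
      (∑ i, b i) - (∑ i, a i) =
        (n : ℤ) ^ 2 - (2 + d) * n + c + d + LongBourbaki.binom (n - 2) ((t : ℤ) - 1)
          + LongBourbaki.binom (n - 1) t * t ∧
      (∑ i, b i ^ 2) - (∑ i, a i ^ 2) =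
        (n : ℤ) ^ 3 - (3 + 2 * d) * n ^ 2 + (d ^ 2 + 4 * d + 1) * n - c ^ 2 - d ^ 2
          + LongBourbaki.binom (n - 1) t * ((t : ℤ) + 1) ^ 2
          - LongBourbaki.binom (n - 2) t * (2 * t + 1)
          - 2 * LongBourbaki.binom (n - 3) ((t : ℤ) - 1)) := by
  have h3 : I.height ≤ 3 := LongBourbaki.height_le_three hseq.injective_f hseq.exact_f_g
    hseq.exact_g_φ hseq.surjective_φ (by omega) (by omega) hIm
  refine ⟨h3, ?_⟩
  -- given the bound, codimension `3` means codimension at least `3`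
  have hiff : I.height = 3 ↔ 3 ≤ I.height := ⟨fun h => h.ge, fun h => le_antisymm h3 h⟩
  have hlt (P : ℕ → Prop) : (∀ k < 3, P k) ↔ P 0 ∧ P 1 ∧ P 2 :=
    ⟨fun h => ⟨h 0 (by omega), h 1 (by omega), h 2 (by omega)⟩, fun h k hk => by
      interval_cases k
      exacts [h.1, h.2.1, h.2.2]⟩
  rw [hiff, hseq.three_le_height_iff hIgr hn (by omega), hlt]
  have e1 := LongBourbaki.altBinomSum_one (show t + 1 ≤ n by omega)
  have e2 := LongBourbaki.altBinomSum_id (show 2 ≤ n by omega) (show t + 1 ≤ n by omega)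
  have e3 := LongBourbaki.altBinomSum_sq (show 3 ≤ n by omega) (show t + 1 ≤ n by omega)
  have e2' : LongBourbaki.altBinomSum n (t + 1) (fun j => -(j : ℤ)) =
      -LongBourbaki.altBinomSum n (t + 1) (fun j => (j : ℤ)) := by
    simp [LongBourbaki.altBinomSum]
  have hcast : ((n - 1 : ℕ) : ℤ) = n - 1 := by push_cast [show 1 ≤ n by omega]; rfl
  simp only [LongBourbaki.altBinomSum_sub_one (show 1 ≤ n by omega), pow_zero, pow_one, neg_sq, e1,
    e2', e2, e3, hcast, Finset.sum_const, Finset.card_univ, Fintype.card_fin, nsmul_eq_mul, mul_one,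
    Finset.sum_neg_distrib]
  refine and_congr ?_ (and_congr ?_ ?_)
  · constructor <;> intro h <;> linarith
  · constructor <;> intro h <;> linear_combination -h
  · constructor <;> intro h <;> linear_combination h
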